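/- Let $s\ge 1$, let $p_1,\dots,p_s$ be pairwise different primes, $\gamma_1,\dots,\gamma_s>0$ and $N\ge 1$. For a prime $p$ and $k\in\mathbb{N}_0$ with base $p$ digits $k=\sum_r k_rp^r$ let $\phi_p(k)=\sum_r k_r p^{-r-1}$ be the radical inverse. It extends to the Monna map $\phi_p:\mathbb{Z}_p\to[0,1)$, $\phi_p(\sum_r z_rp^r)=\sum_r z_rp^{-r-1} \pmod 1$. Let $\phi_p^+:[0,1)\to\mathbb{Z}_p$, $\phi_p^+(\sum_r x_rp^{-r-1})=\sum_r x_rp^r$, where finite expansions are used for $p$-adic rationals. For $k\in\mathbb{N}_0$ and $x\in[0,1)$ put ${}_p\beta_k(x)=\mathrm{e}^{2\pi\mathrm{i}\phi_p(k)\,\phi_p^+(x)}$, where for $z\in\mathbb{Z}_p$ the value $\mathrm{e}^{2\pi\mathrm{i}\phi_p(k)z}$ is obtained by replacing $z$ by its residue modulo $p^a$, $a$ being the number of base $p$ digits of $k$. For $\boldsymbol{k}\in\mathbb{N}_0^s$ and $\boldsymbol{x}\in[0,1)^s$ put $\beta_{\boldsymbol{k}}(\boldsymbol{x})=\prod_{j=1}^s{}_{p_j}\beta_{k_j}(x_j)$.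 Let $\boldsymbol{x}_n=(\phi_{p_1}(n),\dots,\phi_{p_s}(n))$, $n\ge 0$, be the Halton sequence in bases $p_1,\dots,p_s$. For $\boldsymbol{\sigma}\in[0,1)^s$ let $\boldsymbol{x}_n\oplus\boldsymbol{\sigma}$ be the point with components $\phi_{p_j}(\phi_{p_j}^+(x_{n,j})+\phi_{p_j}^+(\sigma_j))$, with addition in $\mathbb{Z}_{p_j}$. Let $\mathcal{H}$ be the weighted anchored Sobolev space with anchor $(1,\dots,1)$, that is, the Hilbert space of real functions on $[0,1]^s$ with reproducing kernel $K(\boldsymbol{x},\boldsymbol{y})=\prod_{j=1}^s(1+\gamma_j\min(1-x_j,1-y_j))$. Let $$e_N(\boldsymbol{\sigma})=\sup_{f\in\mathcal{H},\ \|f\|\le1}\left|\int_{[0,1]^s}f(\boldsymbol{x})\,\mathrm{d}\boldsymbol{x}-\frac1N\sum_{n=0}^{N-1}f(\boldsymbol{x}_n\oplus\boldsymbol{\sigma})\right|$$ be the worst-case error of the shifted Halton sequence, and let $\widehat e_N=\bigl(\mathbb{E}_{\boldsymbol{\sigma}}[e_N(\boldsymbol{\sigma})^2]\bigr)^{1/2}$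 be its root mean square, where the components of $\boldsymbol{\sigma}$ are independent and uniformly distributed in $[0,1)$. Put $r_{p,\gamma}(0)=1+\frac{\gamma}{3}$ and, for $k>0$ with $a$ base $p$ digits and leading digit $\kappa_{a-1}$, $r_{p,\gamma}(k)=\frac{\gamma}{2p^{2a}}\left(\frac{1}{\sin^2(\kappa_{a-1}\pi/p)}-\frac13\right)$; put $r(\boldsymbol{k})=\prod_{j=1}^s r_{p_j,\gamma_j}(k_j)$. Then all these quantities are well defined and finite (every $f\in\mathcal{H}$ is integrable, the supremum $e_N(\boldsymbol{\sigma})$ is finite for every $\boldsymbol{\sigma}\in[0,1)^s$, and $e_N^2$ is integrable over $[0,1)^s$), and $$\widehat e_N^{\,2}=\sum_{\boldsymbol{k}\in\mathbb{N}_0^s\setminus\{\boldsymbol{0}\}}r(\boldsymbol{k})\left|\frac1N\sum_{n=0}^{N-1}\beta_{\boldsymbol{k}}(\boldsymbol{x}_n)\right|^2,$$ where the series converges. -/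

import Mathlib

open MeasureTheory

/-! ### The radical inverse, the Monna map and its inverse -/

/-- The radical inverse function in base `p`: if `n = n₀ + n₁ p + n₂ p² + ⋯` is the base `p`
expansion of `n`, then `φ_p(n) = n₀ / p + n₁ / p² + n₂ / p³ + ⋯` (a finite sum). -/
noncomputable def radicalInverse (p n : ℕ) : ℝ :=
  ∑ r ∈ Finset.range (Nat.digits p n).length, ((n / p ^ r % p : ℕ) : ℝ) / (p : ℝ) ^ (r + 1)

/-- The digit `z_r ∈ {0, …, p - 1}` in the expansion `z = ∑ z_r p ^ r` of a `p`-adic integer;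
`z.appr m ∈ {0, …, p ^ m - 1}` is the residue of `z` modulo `p ^ m`. -/
noncomputable def padicDigit (p : ℕ) [Fact p.Prime] (z : ℤ_[p]) (r : ℕ) : ℕ :=
  z.appr (r + 1) / p ^ r

/-- The Monna map `φ_p : ℤ_p → [0, 1)`, `φ_p(z) = ∑ z_r / p ^ (r + 1)  (mod 1)`. -/
noncomputable def monna (p : ℕ) [Fact p.Prime] (z : ℤ_[p]) : ℝ :=
  Int.fract (∑' r : ℕ, (padicDigit p z r : ℝ) / (p : ℝ) ^ (r + 1))

theorem monna_mem_unitInterval (p : ℕ) [Fact p.Prime] (z : ℤ_[p]) :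
    monna p z ∈ unitInterval :=
  ⟨Int.fract_nonneg _, (Int.fract_lt_one _).le⟩

/-- The map `φ_p⁺ : [0, 1) → ℤ_p`, `φ_p⁺(∑ x_r / p ^ (r + 1)) = ∑ x_r p ^ r`, where the digits are
`x_r = ⌊x p ^ (r + 1)⌋ mod p`, that is, the finite expansion is used for `p`-adic rationals. -/
noncomputable def monnaInv (p : ℕ) [Fact p.Prime] (x : ℝ) : ℤ_[p] :=
  ∑' r : ℕ, ((Real.digits x p r : ℕ) : ℤ_[p]) * (p : ℤ_[p]) ^ r

/-! ### The `p`-adic function system -/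

/-- The character `χ_k(z) = exp(2 π i φ_p(k) z)` of `ℤ_p`. If `k` has `a` digits in base `p`, then
`p ^ a φ_p(k)` is an integer, so that `φ_p(k) z` modulo `1` is given by the residue of `z`
modulo `p ^ a`. -/
noncomputable def padicChar (p : ℕ) [Fact p.Prime] (k : ℕ) (z : ℤ_[p]) : ℂ :=
  Complex.exp (2 * Real.pi * Complex.I *
    ((radicalInverse p k * (z.appr (Nat.digits p k).length : ℝ) : ℝ) : ℂ))

/-- The function `β_k(x) = χ_k(φ_p⁺(x))` on `[0, 1)`. -/
noncomputable def padicBeta (p : ℕ) [Fact p.Prime] (k : ℕ) (x : ℝ) : ℂ :=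
  padicChar p k (monnaInv p x)

/-- The multivariate function `β_k(x) = ∏_j β_{k_j}(x_j)` on `[0, 1)^s`. -/
noncomputable def padicBetaVec {s : ℕ} (p : Fin s → ℕ) [∀ j, Fact (p j).Prime]
    (k : Fin s → ℕ) (x : Fin s → ℝ) : ℂ :=
  ∏ j, padicBeta (p j) (k j) (x j)

/-! ### Halton sequences and shifts -/

/-- The closed unit cube `[0, 1]^s`, with its product Lebesgue measure. -/
abbrev UnitCube (s : ℕ) : Type := Fin s → unitInterval

/-- The `n`-th point of the Halton sequence in bases `p_1, …, p_s`. -/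
noncomputable def halton {s : ℕ} (p : Fin s → ℕ) (n : ℕ) : Fin s → ℝ :=
  fun j => radicalInverse (p j) n

/-- The `p`-adic shift `x ⊕ σ` of points of `[0, 1)^s`, with components
`φ_{p_j}(φ_{p_j}⁺(x_j) + φ_{p_j}⁺(σ_j))`, the addition being that of `ℤ_{p_j}`. -/
noncomputable def padicShift {s : ℕ} (p : Fin s → ℕ) [∀ j, Fact (p j).Prime]
    (x σ : Fin s → ℝ) : UnitCube s :=
  fun j => ⟨monna (p j) (monnaInv (p j) (x j) + monnaInv (p j) (σ j)),
    monna_mem_unitInterval _ _⟩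

/-- The Halton sequence shifted by `σ`. -/
noncomputable def shiftedHalton {s : ℕ} (p : Fin s → ℕ) [∀ j, Fact (p j).Prime]
    (σ : Fin s → ℝ) (n : ℕ) : UnitCube s :=
  padicShift p (halton p n) σ

/-! ### The weighted anchored Sobolev space with anchor `1` -/

/-- The kernel `K(x, y) = ∏_j (1 + γ_j min(1 - x_j, 1 - y_j))`. -/
noncomputable def sobolevKernel {s : ℕ} (γ : Fin s → {g : ℝ // 0 < g}) (x y : UnitCube s) : ℝ :=
  ∏ j, (1 + (γ j : ℝ) * min (1 - (x j : ℝ)) (1 - (y j : ℝ)))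

/-- The same kernel, with a real number `c` regarded as the operator `t ↦ c t` on `ℝ`. -/
noncomputable def sobolevKernelMatrix {s : ℕ} (γ : Fin s → {g : ℝ // 0 < g}) :
    Matrix (UnitCube s) (UnitCube s) (ℝ →L[ℝ] ℝ) :=
  Matrix.of fun x y => sobolevKernel γ x y • ContinuousLinearMap.id ℝ ℝ

theorem posSemidef_min_one_sub {s : ℕ} (j : Fin s) :
    (Matrix.of fun x y : UnitCube s => min (1 - (x j : ℝ)) (1 - (y j : ℝ))).PosSemidef := by
  refine ⟨?_, fun c => ?_⟩
  · ext x y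
    simp [min_comm]
  · let v : UnitCube s → Lp ℝ 2 (volume : Measure ℝ) := fun x =>
      indicatorConstLp 2 (measurableSet_Icc (a := (0 : ℝ)) (b := 1 - (x j : ℝ)))
        measure_Icc_lt_top.ne (1 : ℝ)
    have hv : ∀ x y, min (1 - (x j : ℝ)) (1 - (y j : ℝ)) = inner ℝ (v x) (v y) := by
      intro x y
      have hx := (x j).2.2
      have hy := (y j).2.2
      simp only [v, L2.inner_indicatorConstLp_indicatorConstLp, Set.Icc_inter_Icc]
      simp [hx, hy]
    have key : (0 : ℝ) ≤ inner ℝ (c.sum fun x a => a • v x) (c.sum fun x a => a • v x) :=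
      real_inner_self_nonneg
    rw [Finsupp.sum_inner] at key
    simp only [Finsupp.inner_sum, inner_smul_left, inner_smul_right] at key
    simp only [Matrix.of_apply, hv]
    refine key.trans_eq ?_
    simp only [Finsupp.sum]
    refine Finset.sum_congr rfl fun x _ => Finset.sum_congr rfl fun y _ => ?_
    simp
    ring

theorem posSemidef_sobolevKernel {s : ℕ} (γ : Fin s → {g : ℝ // 0 < g}) :
    (Matrix.of (sobolevKernel γ)).PosSemidef := by
  have hone : (Matrix.of fun _ _ : UnitCube s => (1 : ℝ)).PosSemidef := by
    refine ⟨by ext x y; simp, fun c => ?_⟩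
    have h : (c.sum fun _ a => c.sum fun _ b => star a * 1 * b) =
        (c.sum fun _ a => a) * (c.sum fun _ a => a) := by
      simp [Finsupp.sum, Finset.sum_mul_sum]
    simpa only [Matrix.of_apply, h] using mul_self_nonneg (c.sum fun _ a => a)
  have hprod : ∀ t : Finset (Fin s), (Matrix.of fun x y : UnitCube s =>
      ∏ j ∈ t, (1 + (γ j : ℝ) * min (1 - (x j : ℝ)) (1 - (y j : ℝ)))).PosSemidef := by
    intro t
    induction t using Finset.cons_induction with
    | empty => simpa using hone
    | cons j t hj ih =>
      have hfac := (hone.add ((posSemidef_min_one_sub j).smul (γ j).2.le)).hadamard ih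
      have heq : (Matrix.of fun x y : UnitCube s =>
          ∏ j ∈ Finset.cons j t hj, (1 + (γ j : ℝ) * min (1 - (x j : ℝ)) (1 - (y j : ℝ)))) =
          Matrix.hadamard ((Matrix.of fun _ _ : UnitCube s => (1 : ℝ)) + (γ j : ℝ) •
            (Matrix.of fun x y : UnitCube s => min (1 - (x j : ℝ)) (1 - (y j : ℝ))))
          (Matrix.of fun x y : UnitCube s =>
            ∏ j ∈ t, (1 + (γ j : ℝ) * min (1 - (x j : ℝ)) (1 - (y j : ℝ)))) := by
        ext x y
        simp [Finset.prod_insert hj]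
      rw [heq]
      exact hfac
  exact hprod Finset.univ

theorem posSemidef_sobolevKernelMatrix {s : ℕ} (γ : Fin s → {g : ℝ // 0 < g}) :
    (sobolevKernelMatrix γ).PosSemidef := by
  have hK := posSemidef_sobolevKernel γ
  have hsymm : ∀ x y, sobolevKernel γ x y = sobolevKernel γ y x := fun x y => by
    simp [sobolevKernel, min_comm]
  have e := (RKHS.posSemidef_tfae (K := sobolevKernelMatrix γ)).out 0 2
  refine e.mpr ⟨?_, fun v => ?_⟩
  · ext x y
    simp [sobolevKernelMatrix, hsymm x y, ContinuousLinearMap.star_eq_adjoint,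
      ContinuousLinearMap.adjoint_id]
  · refine (hK.2 v).trans_eq ?_
    simp only [RCLike.re_to_real, Finsupp.sum]
    refine Finset.sum_congr rfl fun x _ => Finset.sum_congr rfl fun y _ => ?_
    simp [sobolevKernelMatrix, hsymm x y]
    ring

instance {s : ℕ} (γ : Fin s → {g : ℝ // 0 < g}) : Fact (sobolevKernelMatrix γ).PosSemidef :=
  ⟨posSemidef_sobolevKernelMatrix γ⟩

/-- The weighted anchored Sobolev space on `[0, 1]^s` with anchor `1`: the Hilbert space of
real-valued functions on `[0, 1]^s` with the above reproducing kernel. -/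
def AnchoredSobolev {s : ℕ} (γ : Fin s → {g : ℝ // 0 < g}) : Type :=
  RKHS.OfKernel (sobolevKernelMatrix γ)

noncomputable instance {s : ℕ} (γ : Fin s → {g : ℝ // 0 < g}) :
    NormedAddCommGroup (AnchoredSobolev γ) :=
  inferInstanceAs (NormedAddCommGroup (RKHS.OfKernel (sobolevKernelMatrix γ)))

noncomputable instance {s : ℕ} (γ : Fin s → {g : ℝ // 0 < g}) :
    InnerProductSpace ℝ (AnchoredSobolev γ) :=
  inferInstanceAs (InnerProductSpace ℝ (RKHS.OfKernel (sobolevKernelMatrix γ)))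

instance {s : ℕ} (γ : Fin s → {g : ℝ // 0 < g}) : CompleteSpace (AnchoredSobolev γ) :=
  inferInstanceAs (CompleteSpace (RKHS.OfKernel (sobolevKernelMatrix γ)))

noncomputable instance {s : ℕ} (γ : Fin s → {g : ℝ // 0 < g}) :
    RKHS ℝ (AnchoredSobolev γ) (UnitCube s) ℝ :=
  inferInstanceAs (RKHS ℝ (RKHS.OfKernel (sobolevKernelMatrix γ)) (UnitCube s) ℝ)

theorem kernel_anchoredSobolev {s : ℕ} (γ : Fin s → {g : ℝ // 0 < g}) (x y : UnitCube s) :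
    RKHS.kernel (AnchoredSobolev γ) x y 1 = sobolevKernel γ x y := by
  have h : RKHS.kernel (AnchoredSobolev γ) = sobolevKernelMatrix γ :=
    RKHS.OfKernel.kernel_ofKernel (K := sobolevKernelMatrix γ)
  rw [h]
  simp [sobolevKernelMatrix]

/-! ### Worst-case errors -/

/-- The integration error `∫ f - N⁻¹ ∑_{n < N} f(x_n)` of the quasi-Monte Carlo rule based on the
first `N` points of a sequence. -/
noncomputable def qmcError {s : ℕ} (x : ℕ → UnitCube s) (N : ℕ) (f : UnitCube s → ℝ) : ℝ :=
  (∫ y, f y) - (1 / (N : ℝ)) * ∑ n ∈ Finset.range N, f (x n)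

/-- The worst-case error: the supremum of the absolute error over the unit ball of a Hilbert
space `H` of functions on `[0, 1]^s`. -/
noncomputable def worstCaseError {s : ℕ} (H : Type) [NormedAddCommGroup H]
    [InnerProductSpace ℝ H] [RKHS ℝ H (UnitCube s) ℝ] (x : ℕ → UnitCube s) (N : ℕ) : ℝ :=
  ⨆ f : {f : H // ‖f‖ ≤ 1}, |qmcError x N (f : H)|

/-- The root mean square worst-case error of the randomly shifted Halton sequence, the components
of the shift being independent and uniformly distributed in `[0, 1)`. -/
noncomputable def rmsWorstCaseError {s : ℕ} (p : Fin s → ℕ) [∀ j, Fact (p j).Prime]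
    (γ : Fin s → {g : ℝ // 0 < g}) (N : ℕ) : ℝ :=
  √(∫ σ in Set.univ.pi (fun _ : Fin s => Set.Ico (0 : ℝ) 1),
    worstCaseError (AnchoredSobolev γ) (shiftedHalton p σ) N ^ 2)

/-! ### The coefficients -/

/-- `r_{p,γ}(0) = 1 + γ / 3`, and `r_{p,γ}(k) = γ / (2 p ^ (2 a)) (1 / sin²(κ π / p) - 1 / 3)` if
`k > 0` has `a` digits in base `p` and leading digit `κ = ⌊k / p ^ (a - 1)⌋`. -/
noncomputable def rCoeff (p : ℕ) (γ : ℝ) (k : ℕ) : ℝ :=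
  if k = 0 then 1 + γ / 3
  else
    γ / (2 * (p : ℝ) ^ (2 * (Nat.digits p k).length)) *
      (1 / Real.sin (((k / p ^ ((Nat.digits p k).length - 1) : ℕ) : ℝ) * Real.pi / p) ^ 2 - 1 / 3)

/-- `r_{p,γ}(k) = ∏_j r_{p_j,γ_j}(k_j)`. -/
noncomputable def rCoeffVec {s : ℕ} (p : Fin s → ℕ) (γ : Fin s → {g : ℝ // 0 < g})
    (k : Fin s → ℕ) : ℝ :=
  ∏ j, rCoeff (p j) (γ j) (k j)

open Filter Topology

/-! ### Sums over residues, digit by digit -/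

/-! The error functional is represented by an element h of the space, so the squared worst-case
error is ‖h‖² (`worstCaseError_eq_norm`), a constant minus a sum of kernel means plus a double sum
of values K(x_n, x_m) (`worstCaseError_sq`). Each shifted coordinate is uniformly distributed, so
after averaging the first two terms combine to -∏(1 + γ_j/3). The shift components are independent,
so the averaged kernel values factor over the coordinates. It remains to expand each factor in
characters of ℤ_p: its coefficients are r_{p,γ}(k), the double sum then becomes ∑ r(k) |N⁻¹ ∑
β_k(x_n)|², and the term k = 0 cancels the constant.

In one coordinate, min(1 - a, 1 - b) = 1 - max(a, b), so what matters is the mean of max(φ(x + U),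
φ(y + U)) with U uniform on ℤ_p. By translation invariance it depends only on z = y - x. Modulo p^M
it is an average over residues, and removing one digit at a time gives (1 - p^{-M})/2 + `digitGap p
M z` (`sum_max_monnaTrunc`): the maximum is decided at the first nonzero digit e of z.

On the Fourier side, the partial sum of r_{p,γ}(k) χ_k(z) over 0 < k < p^M obeys the same digit
recursion and equals γ(1/6 - `digitGap p M z`) up to a term that vanishes in the limit
(`sum_rCoeffPos_mul_natChar`). The one-digit case is the cosecant sum ∑ ω^{kn}/sin²(kπ/p) = (p² -
1)/3 - 2e(p - e), with e = n mod p (`cscSum_eq`). Letting M → ∞ gives `hasSum_rCoeff_mul_padicChar`.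
-/

theorem sum_range_mul_eq {A : Type*} [AddCommMonoid A] (f : ℕ → A) (p m : ℕ) :
    ∑ n ∈ Finset.range (p * m), f n =
      ∑ n ∈ Finset.range m, ∑ d ∈ Finset.range p, f (d + p * n) := by
  induction m with
  | zero => simp
  | succ m ih =>
    rw [Finset.sum_range_succ, ← ih, Nat.mul_succ, Finset.sum_range_add]
    simp [add_comm]

theorem sum_range_add_of_periodic (f : ℕ → ℝ) (P : ℕ) (hf : ∀ n, f (n + P) = f n) (c : ℕ) :
    ∑ n ∈ Finset.range P, f (n + c) = ∑ n ∈ Finset.range P, f n := by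
  induction c with
  | zero => simp
  | succ c ih =>
    rw [← ih]
    have h1 := Finset.sum_range_succ (fun n => f (n + c)) P
    have h2 := Finset.sum_range_succ' (fun n => f (n + c)) P
    have h3 : f (P + c) = f (0 + c) := by rw [add_comm, hf, zero_add]
    have h4 : ∀ n, f (n + (c + 1)) = f (n + 1 + c) := fun n => by congr 1; ring
    simp only [h4]
    linarith

theorem sum_range_cast (n : ℕ) : ∑ d ∈ Finset.range n, (d : ℝ) = n * (n - 1) / 2 := by
  induction n with
  | zero => simp
  | succ n ih => rw [Finset.sum_range_succ, ih]; push_cast; ring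

theorem sum_range_cast_sq (n : ℕ) :
    ∑ d ∈ Finset.range n, (d : ℝ) ^ 2 = n * (n - 1) * (2 * n - 1) / 6 := by
  induction n with
  | zero => simp
  | succ n ih => rw [Finset.sum_range_succ, ih]; push_cast; ring

/-- For d < p - e the shift by e does not wrap around and raises the maximum by e; for the other d
it wraps below d. Hence the excess over ∑ d is e for each of p - e values. -/
theorem sum_max_add_mod (p e : ℕ) (he : e < p) :
    ∑ d ∈ Finset.range p, (max d ((d + e) % p) : ℕ) =
      ((p : ℝ) * (p - 1) / 2 + e * (p - e) : ℝ) := by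
  obtain ⟨q, rfl⟩ : ∃ q, p = q + e := ⟨p - e, by omega⟩
  have hs := sum_range_cast (q + e)
  push_cast
  rw [Finset.sum_range_add] at hs ⊢
  have h1 : ∀ d ∈ Finset.range q, max (d : ℝ) (((d + e) % (q + e) : ℕ) : ℝ) = d + e := by
    intro d hd
    rw [Nat.mod_eq_of_lt (by have := Finset.mem_range.1 hd; omega), max_eq_right] <;>
    push_cast <;> linarith [(Nat.cast_nonneg e : (0 : ℝ) ≤ e)]
  have h2 : ∀ d ∈ Finset.range e,
      max ((q + d : ℕ) : ℝ) (((q + d + e) % (q + e) : ℕ) : ℝ) = ((q + d : ℕ) : ℝ) := by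
    intro d hd
    have hd := Finset.mem_range.1 hd
    rw [show q + d + e = d + (q + e) by ring, Nat.add_mod_right,
      Nat.mod_eq_of_lt (by omega), max_eq_left]
    exact_mod_cast Nat.le_add_left _ _
  rw [Finset.sum_congr rfl h1, Finset.sum_congr rfl h2, Finset.sum_add_distrib]
  simp only [Finset.sum_const, Finset.card_range, nsmul_eq_mul]
  push_cast at hs ⊢
  linarith

/-! ### The truncated radical inverse -/

/-- The radical inverse of the first `M` base `p` digits of `n`. -/
noncomputable def monnaTrunc (p : ℕ) : ℕ → ℕ → ℝ
  | 0, _ => 0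
  | M + 1, n => ((n % p : ℕ) + monnaTrunc p M (n / p)) / p

theorem monnaTrunc_nonneg (p M n : ℕ) : 0 ≤ monnaTrunc p M n := by
  induction M generalizing n with
  | zero => simp [monnaTrunc]
  | succ M ih => have := ih (n / p); simp only [monnaTrunc]; positivity

theorem monnaTrunc_lt_one {p : ℕ} (hp : 0 < p) (M n : ℕ) : monnaTrunc p M n < 1 := by
  induction M generalizing n with
  | zero => simp [monnaTrunc]
  | succ M ih =>
    have := ih (n / p)
    have hp' : (0 : ℝ) < p := by exact_mod_cast hp
    have h2 : ((n % p : ℕ) : ℝ) + 1 ≤ p := by exact_mod_cast Nat.mod_lt n hp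
    rw [monnaTrunc, div_lt_one hp']
    linarith

theorem monnaTrunc_add_pow {p : ℕ} (hp : 0 < p) (M n : ℕ) :
    monnaTrunc p M (n + p ^ M) = monnaTrunc p M n := by
  induction M generalizing n with
  | zero => simp [monnaTrunc]
  | succ M ih =>
    rw [monnaTrunc, monnaTrunc, pow_succ', Nat.add_mul_mod_self_left,
      Nat.add_mul_div_left _ _ hp, ih]

theorem monnaTrunc_mod {p : ℕ} (hp : 0 < p) (M n : ℕ) :
    monnaTrunc p M (n % p ^ M) = monnaTrunc p M n := by
  have h : Function.Periodic (monnaTrunc p M) (p ^ M) := monnaTrunc_add_pow hp M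
  exact h.map_mod_nat n

theorem monnaTrunc_congr {p : ℕ} (hp : 0 < p) {M m n : ℕ} (h : m ≡ n [MOD p ^ M]) :
    monnaTrunc p M m = monnaTrunc p M n := by
  rw [← monnaTrunc_mod hp, h, monnaTrunc_mod hp]

theorem sum_monnaTrunc {p : ℕ} (hp : 0 < p) (M : ℕ) :
    ∑ n ∈ Finset.range (p ^ M), monnaTrunc p M n = ((p : ℝ) ^ M - 1) / 2 := by
  have hp' : (p : ℝ) ≠ 0 := by positivity
  induction M with
  | zero => simp [monnaTrunc]
  | succ M ih =>
    rw [pow_succ', sum_range_mul_eq]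
    have h : ∀ n ∈ Finset.range (p ^ M), ∑ d ∈ Finset.range p, monnaTrunc p (M + 1) (d + p * n) =
        (p - 1) / 2 + monnaTrunc p M n := by
      intro n _
      have : ∀ d ∈ Finset.range p, monnaTrunc p (M + 1) (d + p * n) =
          (d : ℝ) * (p : ℝ)⁻¹ + monnaTrunc p M n * (p : ℝ)⁻¹ := by
        intro d hd
        have hd := Finset.mem_range.1 hd
        rw [monnaTrunc, Nat.add_mul_mod_self_left, Nat.mod_eq_of_lt hd,
          Nat.add_mul_div_left _ _ hp, Nat.div_eq_of_lt hd, zero_add]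
        ring
      rw [Finset.sum_congr rfl this, Finset.sum_add_distrib, ← Finset.sum_mul, sum_range_cast]
      simp only [Finset.sum_const, Finset.card_range, nsmul_eq_mul]
      field_simp
    rw [Finset.sum_congr rfl h, Finset.sum_add_distrib, ih]
    simp only [Finset.sum_const, Finset.card_range, nsmul_eq_mul]
    push_cast
    ring

theorem sum_monnaTrunc_sq {p : ℕ} (hp : 0 < p) (M : ℕ) :
    ∑ n ∈ Finset.range (p ^ M), monnaTrunc p M n ^ 2 =
      ((p : ℝ) ^ M - 1) * (2 * (p : ℝ) ^ M - 1) / (6 * (p : ℝ) ^ M) := by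
  have hp' : (p : ℝ) ≠ 0 := by positivity
  induction M with
  | zero => simp [monnaTrunc]
  | succ M ih =>
    rw [pow_succ', sum_range_mul_eq]
    have h : ∀ n ∈ Finset.range (p ^ M),
        ∑ d ∈ Finset.range p, monnaTrunc p (M + 1) (d + p * n) ^ 2 =
        (p - 1) * (2 * p - 1) / (6 * p) + (p - 1) / p * monnaTrunc p M n +
          (p : ℝ)⁻¹ * monnaTrunc p M n ^ 2 := by
      intro n _
      have : ∀ d ∈ Finset.range p, monnaTrunc p (M + 1) (d + p * n) ^ 2 =
          (d : ℝ) ^ 2 * ((p : ℝ)⁻¹) ^ 2 + d * (2 * monnaTrunc p M n * ((p : ℝ)⁻¹) ^ 2) +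
            monnaTrunc p M n ^ 2 * ((p : ℝ)⁻¹) ^ 2 := by
        intro d hd
        have hd := Finset.mem_range.1 hd
        rw [monnaTrunc, Nat.add_mul_mod_self_left, Nat.mod_eq_of_lt hd,
          Nat.add_mul_div_left _ _ hp, Nat.div_eq_of_lt hd, zero_add]
        ring
      rw [Finset.sum_congr rfl this, Finset.sum_add_distrib, Finset.sum_add_distrib,
        ← Finset.sum_mul, ← Finset.sum_mul, sum_range_cast, sum_range_cast_sq]
      simp only [Finset.sum_const, Finset.card_range, nsmul_eq_mul]
      field_simp
    rw [Finset.sum_congr rfl h, Finset.sum_add_distrib, Finset.sum_add_distrib, ← Finset.mul_sum,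
      ← Finset.mul_sum, ih, sum_monnaTrunc hp]
    simp only [Finset.sum_const, Finset.card_range, nsmul_eq_mul]
    push_cast
    field_simp
    ring

/-- If `e` is the first nonzero base `p` digit of `z`, and it is at position `m < M`, this is
`e (p - e) / p ^ (m + 2)`; it vanishes if there is no such digit. -/
noncomputable def digitGap (p : ℕ) : ℕ → ℕ → ℝ
  | 0, _ => 0
  | M + 1, z => if z % p = 0 then digitGap p M (z / p) / p
      else ((z % p : ℕ) : ℝ) * (p - (z % p : ℕ)) / (p : ℝ) ^ 2

/-- If p divides z, the lowest digits of n and n + z agree and the comparison passes to the higher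
digits. Otherwise they always differ and decide the maximum, while the higher digits run over a full
period and contribute their plain average, whichever argument wins. -/
theorem sum_max_monnaTrunc {p : ℕ} (hp : 0 < p) (M z : ℕ) :
    ∑ n ∈ Finset.range (p ^ M), max (monnaTrunc p M n) (monnaTrunc p M (n + z)) =
      ((p : ℝ) ^ M - 1) / 2 + (p : ℝ) ^ M * digitGap p M z := by
  have hp' : (0 : ℝ) < p := by positivity
  induction M generalizing z with
  | zero => simp [monnaTrunc, digitGap]
  | succ M ih =>
    have hφ : ∀ n, ∀ d ∈ Finset.range p, monnaTrunc p (M + 1) (d + p * n) =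
        (d + monnaTrunc p M n) / p := by
      intro n d hd
      have hd := Finset.mem_range.1 hd
      rw [monnaTrunc, Nat.add_mul_mod_self_left, Nat.mod_eq_of_lt hd,
        Nat.add_mul_div_left _ _ hp, Nat.div_eq_of_lt hd, zero_add]
    rw [pow_succ', sum_range_mul_eq]
    by_cases hz : z % p = 0
    · have h : ∀ n ∈ Finset.range (p ^ M), ∑ d ∈ Finset.range p,
          max (monnaTrunc p (M + 1) (d + p * n)) (monnaTrunc p (M + 1) (d + p * n + z)) =
          (p - 1) / 2 + max (monnaTrunc p M n) (monnaTrunc p M (n + z / p)) := by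
        intro n _
        have : ∀ d ∈ Finset.range p,
            max (monnaTrunc p (M + 1) (d + p * n)) (monnaTrunc p (M + 1) (d + p * n + z)) =
            (d : ℝ) * (p : ℝ)⁻¹ +
              max (monnaTrunc p M n) (monnaTrunc p M (n + z / p)) * (p : ℝ)⁻¹ := by
          intro d hd
          have hzd : d + p * n + z = d + p * (n + z / p) := by
            rw [mul_add, Nat.mul_div_cancel' (Nat.dvd_of_mod_eq_zero hz)]; ring
          rw [hzd, hφ _ _ hd, hφ _ _ hd, max_div_div_right hp'.le, max_add_add_left]
          ring
        rw [Finset.sum_congr rfl this, Finset.sum_add_distrib, ← Finset.sum_mul, sum_range_cast]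
        simp only [Finset.sum_const, Finset.card_range, nsmul_eq_mul]
        field_simp
      rw [Finset.sum_congr rfl h, Finset.sum_add_distrib, ih, digitGap, if_pos hz]
      simp only [Finset.sum_const, Finset.card_range, nsmul_eq_mul]
      push_cast
      field_simp
      ring
    · have he : z % p < p := Nat.mod_lt z hp
      rw [Finset.sum_comm]
      have h : ∀ d ∈ Finset.range p, ∑ n ∈ Finset.range (p ^ M),
          max (monnaTrunc p (M + 1) (d + p * n)) (monnaTrunc p (M + 1) (d + p * n + z)) =
          (max d ((d + z % p) % p) : ℕ) * ((p : ℝ) ^ M / p) + ((p : ℝ) ^ M - 1) / 2 / p := by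
        intro d hd
        have hd' := Finset.mem_range.1 hd
        have hψ : ∀ n, monnaTrunc p (M + 1) (d + p * n + z) =
            (((d + z % p) % p : ℕ) + monnaTrunc p M (n + (d + z) / p)) / p := by
          intro n
          rw [show d + p * n + z = d + z + p * n by ring, monnaTrunc, Nat.add_mul_mod_self_left,
            Nat.add_mul_div_left _ _ hp, Nat.add_mod_mod, add_comm n]
        have hne : d ≠ (d + z % p) % p := by
          intro h
          rcases lt_or_ge (d + z % p) p with h1 | h1
          · rw [Nat.mod_eq_of_lt h1] at h; omega
          · rw [Nat.mod_eq_sub_mod h1, Nat.mod_eq_of_lt (by omega)] at h; omega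
        simp only [hφ _ _ hd, hψ]
        have hs := sum_range_add_of_periodic (monnaTrunc p M) (p ^ M)
          (monnaTrunc_add_pow hp M) ((d + z) / p)
        rcases lt_or_gt_of_ne hne with hlt | hgt
        · have : ∀ n ∈ Finset.range (p ^ M), max (((d : ℝ) + monnaTrunc p M n) / p)
              ((((d + z % p) % p : ℕ) + monnaTrunc p M (n + (d + z) / p)) / p) =
              ((d + z % p) % p : ℕ) / p + monnaTrunc p M (n + (d + z) / p) * (p : ℝ)⁻¹ := by
            intro n _
            rw [max_eq_right]
            · ring
            · gcongr ?_ / _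
              have h1 := monnaTrunc_lt_one hp M n
              have h2 := monnaTrunc_nonneg p M (n + (d + z) / p)
              have h3 : (d : ℝ) + 1 ≤ ((d + z % p) % p : ℕ) := by exact_mod_cast hlt
              linarith
          rw [Finset.sum_congr rfl this, Finset.sum_add_distrib, ← Finset.sum_mul, hs,
            sum_monnaTrunc hp, max_eq_right hlt.le]
          simp only [Finset.sum_const, Finset.card_range, nsmul_eq_mul]
          push_cast
          ring
        · have : ∀ n ∈ Finset.range (p ^ M), max (((d : ℝ) + monnaTrunc p M n) / p)
              ((((d + z % p) % p : ℕ) + monnaTrunc p M (n + (d + z) / p)) / p) =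
              d / p + monnaTrunc p M n * (p : ℝ)⁻¹ := by
            intro n _
            rw [max_eq_left]
            · ring
            · gcongr ?_ / _
              have h1 := monnaTrunc_lt_one hp M (n + (d + z) / p)
              have h2 := monnaTrunc_nonneg p M n
              have h3 : (((d + z % p) % p : ℕ) : ℝ) + 1 ≤ d := by exact_mod_cast hgt
              linarith
          rw [Finset.sum_congr rfl this, Finset.sum_add_distrib, ← Finset.sum_mul,
            sum_monnaTrunc hp, max_eq_left hgt.le]
          simp only [Finset.sum_const, Finset.card_range, nsmul_eq_mul]
          push_cast
          ring
      rw [Finset.sum_congr rfl h, Finset.sum_add_distrib, ← Finset.sum_mul,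
        ← Nat.cast_sum, sum_max_add_mod p _ he, digitGap, if_neg hz]
      simp only [Finset.sum_const, Finset.card_range, nsmul_eq_mul]
      field_simp
      ring

/-! ### A cosecant sum -/

theorem exp_two_pi_I_div_pow (p n : ℕ) (hp : 0 < p) :
    Complex.exp (2 * Real.pi * Complex.I / p) ^ n = 1 ↔ p ∣ n :=
  (Complex.isPrimitiveRoot_exp p hp.ne').pow_eq_one_iff_dvd n

theorem sum_rootOfUnity_pow {p : ℕ} (hp : 0 < p) (n : ℕ) :
    ∑ k ∈ Finset.range p, Complex.exp (2 * Real.pi * Complex.I / p) ^ (k * n) =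
      if n % p = 0 then (p : ℂ) else 0 := by
  set ω := Complex.exp (2 * Real.pi * Complex.I / p) with hω
  have hωp : ω ^ p = 1 := (exp_two_pi_I_div_pow p p hp).2 dvd_rfl
  have h : ∀ k, ω ^ (k * n) = (ω ^ n) ^ k := fun k => by rw [← pow_mul, mul_comm]
  simp only [h]
  split_ifs with hn
  · have : ω ^ n = 1 := (exp_two_pi_I_div_pow p n hp).2 (Nat.dvd_of_mod_eq_zero hn)
    simp [this]
  · have : ω ^ n ≠ 1 := fun h => hn (Nat.mod_eq_zero_of_dvd ((exp_two_pi_I_div_pow p n hp).1 h))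
    rw [geom_sum_eq this, ← pow_mul, mul_comm, pow_mul, hωp]
    simp

/-- The sum `∑ ω ^ (k n) / sin² (k π / p)` over `0 < k < p`, where `ω = exp (2 π i / p)`. -/
noncomputable def cscSum (p n : ℕ) : ℂ :=
  ∑ k ∈ Finset.range p, ((1 / Real.sin (k * Real.pi / p) ^ 2 : ℝ) : ℂ) *
    Complex.exp (2 * Real.pi * Complex.I / p) ^ (k * n)

theorem sub_one_sq_eq_sin_sq (p k : ℕ) :
    (Complex.exp (2 * Real.pi * Complex.I / p) ^ k - 1) ^ 2 =
      -4 * ((Real.sin (k * Real.pi / p) ^ 2 : ℝ) : ℂ) *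
        Complex.exp (2 * Real.pi * Complex.I / p) ^ k := by
  set t : ℂ := k * Real.pi / p with ht
  have h1 : Complex.exp (2 * Real.pi * Complex.I / p) ^ k = Complex.exp (t * Complex.I) ^ 2 := by
    rw [← Complex.exp_nat_mul, ← Complex.exp_nat_mul]
    congr 1
    rw [ht]; push_cast; ring
  have h2 : Complex.exp (-t * Complex.I) * Complex.exp (t * Complex.I) = 1 := by
    rw [← Complex.exp_add]; simp
  have h3 : ((Real.sin (k * Real.pi / p) ^ 2 : ℝ) : ℂ) = Complex.sin t ^ 2 := by
    rw [ht]; push_cast; rfl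
  rw [h1, h3, Complex.sin]
  set u := Complex.exp (t * Complex.I)
  set v := Complex.exp (-t * Complex.I)
  have hI := Complex.I_sq
  linear_combination ((v - u) ^ 2 * u ^ 2) * hI - (u * v + 1 - 2 * u ^ 2) * h2

theorem sin_natCast_mul_pi_div_ne_zero {p k : ℕ} (h0 : k ≠ 0) (hk : k < p) :
    Real.sin (k * Real.pi / p) ≠ 0 := by
  have hk0 : (0 : ℝ) < k := by exact_mod_cast Nat.pos_of_ne_zero h0
  have hkp : (k : ℝ) < p := by exact_mod_cast hk
  have hp : (0 : ℝ) < p := hk0.trans hkp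
  refine (Real.sin_pos_of_pos_of_lt_pi (by positivity) ?_).ne'
  rw [div_lt_iff₀ hp]
  nlinarith [Real.pi_pos]

/-- The second difference multiplies each term by (ω^k - 1)² = -4 sin²(kπ/p) ω^k, which cancels the
denominator and leaves a sum of roots of unity. The term k = 0 of `cscSum` is zero because 1 / 0 =
0; completing the sum of roots of unity by its k = 0 term gives the constant 4. -/
theorem cscSum_second_difference {p : ℕ} (hp : 0 < p) (n : ℕ) :
    cscSum p (n + 2) - 2 * cscSum p (n + 1) + cscSum p n =
      4 - 4 * if (n + 1) % p = 0 then (p : ℂ) else 0 := by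
  obtain ⟨q, rfl⟩ : ∃ q, p = q + 1 := ⟨p - 1, by omega⟩
  rw [← sum_rootOfUnity_pow hp (n + 1)]
  simp only [cscSum, Finset.mul_sum, ← Finset.sum_sub_distrib, ← Finset.sum_add_distrib]
  rw [Finset.sum_range_succ', Finset.sum_range_succ' (fun k => 4 * _)]
  have h : ∀ k ∈ Finset.range q,
      ((1 / Real.sin ((k + 1 : ℕ) * Real.pi / (q + 1 : ℕ)) ^ 2 : ℝ) : ℂ) *
        Complex.exp (2 * Real.pi * Complex.I / (q + 1 : ℕ)) ^ ((k + 1) * (n + 2)) -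
      2 * (((1 / Real.sin ((k + 1 : ℕ) * Real.pi / (q + 1 : ℕ)) ^ 2 : ℝ) : ℂ) *
        Complex.exp (2 * Real.pi * Complex.I / (q + 1 : ℕ)) ^ ((k + 1) * (n + 1))) +
      ((1 / Real.sin ((k + 1 : ℕ) * Real.pi / (q + 1 : ℕ)) ^ 2 : ℝ) : ℂ) *
        Complex.exp (2 * Real.pi * Complex.I / (q + 1 : ℕ)) ^ ((k + 1) * n) =
      - (4 * Complex.exp (2 * Real.pi * Complex.I / (q + 1 : ℕ)) ^ ((k + 1) * (n + 1))) := by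
    intro k hk
    have h1 := sub_one_sq_eq_sin_sq (q + 1) (k + 1)
    have h2 := sin_natCast_mul_pi_div_ne_zero (p := q + 1) (k := k + 1) (by omega)
      (by have := Finset.mem_range.1 hk; omega)
    set σ := Real.sin ((k + 1 : ℕ) * Real.pi / (q + 1 : ℕ))
    set ω := Complex.exp (2 * Real.pi * Complex.I / (q + 1 : ℕ))
    have h3 : ((1 / σ ^ 2 : ℝ) : ℂ) * ((σ ^ 2 : ℝ) : ℂ) = 1 := by
      rw [← Complex.ofReal_mul, one_div, inv_mul_cancel₀ (pow_ne_zero 2 h2)]; simp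
    have e1 : ω ^ ((k + 1) * (n + 2)) = ω ^ ((k + 1) * n) * (ω ^ (k + 1)) ^ 2 := by
      rw [← pow_mul, ← pow_add]; ring_nf
    have e2 : ω ^ ((k + 1) * (n + 1)) = ω ^ ((k + 1) * n) * ω ^ (k + 1) := by
      rw [← pow_add]; ring_nf
    rw [e1, e2]
    linear_combination ((1 / σ ^ 2 : ℝ) : ℂ) * ω ^ ((k + 1) * n) * h1 -
      4 * ω ^ ((k + 1) * n) * ω ^ (k + 1) * h3
  rw [Finset.sum_congr rfl h]
  simp [Finset.sum_neg_distrib]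

theorem cscSum_mod {p : ℕ} (hp : 0 < p) (n : ℕ) : cscSum p (n % p) = cscSum p n := by
  have hωp := (exp_two_pi_I_div_pow p p hp).2 dvd_rfl
  refine Finset.sum_congr rfl fun k _ => ?_
  have h : k * n = k * (n % p) + p * (k * (n / p)) := by
    conv_lhs => rw [← Nat.mod_add_div n p]
    ring
  rw [h, pow_add, pow_mul _ p, hωp, one_pow, mul_one]

theorem sum_cscSum {p : ℕ} (hp : 0 < p) : ∑ n ∈ Finset.range p, cscSum p n = 0 := by
  simp only [cscSum]
  rw [Finset.sum_comm]
  refine Finset.sum_eq_zero fun k hk => ?_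
  rw [← Finset.mul_sum]
  by_cases h0 : k = 0
  · simp [h0]
  · have := sum_rootOfUnity_pow hp k
    rw [Nat.mod_eq_of_lt (Finset.mem_range.1 hk), if_neg h0] at this
    simp only [mul_comm k, this, mul_zero]

/-- The second difference is 4 away from multiples of p, so on 0, …, p the sum is a quadratic
polynomial with leading coefficient 2. Periodicity determines the linear coefficient -2p, and
vanishing mean over a period determines the constant. -/
theorem cscSum_eq_of_lt {p : ℕ} (hp : 0 < p) {e : ℕ} (he : e < p) :
    cscSum p e = ((((p : ℝ) ^ 2 - 1) / 3 - 2 * e * (p - e) : ℝ) : ℂ) := by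
  have hp0 : (p : ℂ) ≠ 0 := by exact_mod_cast hp.ne'
  -- Chosen so that the quadratic is correct at n = 0 and n = 1.
  set α := cscSum p 1 - cscSum p 0 - 2 with hα
  have key : ∀ n, n < p → cscSum p n = cscSum p 0 + α * n + 2 * n ^ 2 ∧
      cscSum p (n + 1) = cscSum p 0 + α * (n + 1 : ℕ) + 2 * ((n + 1 : ℕ) : ℂ) ^ 2 := by
    intro n
    induction n with
    | zero => intro _; constructor <;> push_cast [hα] <;> ring
    | succ n ih =>
      intro hn
      obtain ⟨h1, h2⟩ := ih (by omega)
      refine ⟨h2, ?_⟩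
      have h := cscSum_second_difference hp n
      rw [Nat.mod_eq_of_lt hn, if_neg (by omega), h1, h2] at h
      push_cast at h ⊢
      linear_combination h
  have hper : cscSum p p = cscSum p 0 := by rw [← cscSum_mod hp p, Nat.mod_self]
  have hαp : α = -2 * p := by
    have h := (key (p - 1) (by omega)).2
    rw [Nat.sub_add_cancel hp, hper] at h
    have : (p : ℂ) * (α + 2 * p) = 0 := by linear_combination -h
    rcases mul_eq_zero.1 this with h | h
    · exact absurd h hp0
    · linear_combination h
  have h0 : cscSum p 0 = ((p : ℂ) ^ 2 - 1) / 3 := by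
    have h := sum_cscSum hp
    rw [Finset.sum_congr rfl fun n hn => (key n (Finset.mem_range.1 hn)).1] at h
    have s1 : ∑ d ∈ Finset.range p, (d : ℂ) = p * (p - 1) / 2 := by
      have := congrArg Complex.ofReal (sum_range_cast p)
      push_cast at this
      exact this
    have s2 : ∑ d ∈ Finset.range p, (d : ℂ) ^ 2 = p * (p - 1) * (2 * p - 1) / 6 := by
      have := congrArg Complex.ofReal (sum_range_cast_sq p)
      push_cast at this
      exact this
    rw [Finset.sum_add_distrib, Finset.sum_add_distrib, ← Finset.mul_sum, ← Finset.mul_sum, s1, s2,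
      hαp] at h
    simp only [Finset.sum_const, Finset.card_range, nsmul_eq_mul] at h
    refine mul_left_cancel₀ hp0 ?_
    linear_combination h
  rw [(key e he).1, h0, hαp]
  push_cast
  ring

theorem cscSum_eq {p : ℕ} (hp : 0 < p) (n : ℕ) :
    cscSum p n = ((((p : ℝ) ^ 2 - 1) / 3 - 2 * (n % p : ℕ) * (p - (n % p : ℕ)) : ℝ) : ℂ) := by
  rw [← cscSum_mod hp, cscSum_eq_of_lt hp (Nat.mod_lt n hp)]

/-! ### Peeling off the lowest digit -/

theorem digits_length_add_mul {p : ℕ} (hp : 1 < p) {d k : ℕ} (hd : d < p) (h : k ≠ 0) :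
    (Nat.digits p (d + p * k)).length = (Nat.digits p k).length + 1 := by
  rw [Nat.digits_add p hp d k hd (Or.inr h), List.length_cons]

theorem radicalInverse_add_mul {p : ℕ} (hp : 1 < p) {d : ℕ} (hd : d < p) (k : ℕ) :
    radicalInverse p (d + p * k) = (d + radicalInverse p k) / p := by
  by_cases h : d = 0 ∧ k = 0
  · simp [h.1, h.2, radicalInverse]
  · have hlen : (Nat.digits p (d + p * k)).length = (Nat.digits p k).length + 1 := by
      rw [Nat.digits_add p hp d k hd (by tauto), List.length_cons]
    rw [radicalInverse, hlen, Finset.sum_range_succ', radicalInverse, add_div, Finset.sum_div,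
      add_comm]
    congr 1
    · simp [Nat.add_mul_mod_self_left, Nat.mod_eq_of_lt hd]
    · refine Finset.sum_congr rfl fun r _ => ?_
      rw [pow_succ', ← Nat.div_div_eq_div_mul, Nat.add_mul_div_left _ _ (by omega),
        Nat.div_eq_of_lt hd, zero_add, pow_succ' (p : ℝ) (r + 1), mul_comm, div_div, mul_comm]

theorem radicalInverse_of_lt {p : ℕ} (hp : 1 < p) {d : ℕ} (hd : d < p) :
    radicalInverse p d = d / p := by
  have := radicalInverse_add_mul hp hd 0
  simpa [radicalInverse] using this

/-- The coefficient `r_{p,γ}(k)`, with the one at `k = 0` replaced by `0`. -/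
noncomputable def rCoeffPos (p : ℕ) (γ : ℝ) (k : ℕ) : ℝ := if k = 0 then 0 else rCoeff p γ k

/-- At d = 0 the value 1 / 0 = 0 leaves -1/3, which the last term compensates; the formula is thus
uniform over all residues d. -/
theorem rCoeffPos_of_lt {p : ℕ} (γ : ℝ) {d : ℕ} (hd : d < p) :
    rCoeffPos p γ d = γ / (2 * (p : ℝ) ^ 2) *
      (1 / Real.sin (d * Real.pi / p) ^ 2 - 1 / 3 + if d = 0 then 1 / 3 else 0) := by
  by_cases h : d = 0
  · simp [h, rCoeffPos]
  · simp [h, rCoeffPos, rCoeff, Nat.digits_of_lt p d h hd]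

/-- A new lowest digit below k > 0 lengthens the expansion by one and keeps the leading digit, so
the coefficient is divided by p² independently of d. For k = 0 the digit d is itself the leading
one. -/
theorem rCoeffPos_add_mul {p : ℕ} (hp : 1 < p) (γ : ℝ) {d : ℕ} (hd : d < p) (k : ℕ) :
    rCoeffPos p γ (d + p * k) =
      (if k = 0 then rCoeffPos p γ d else 0) + rCoeffPos p γ k / (p : ℝ) ^ 2 := by
  by_cases h : k = 0
  · simp [h, rCoeffPos]
  · have hl : (Nat.digits p k).length ≠ 0 := by
      rw [Ne, List.length_eq_zero_iff]
      exact Nat.digits_ne_nil_iff_ne_zero.2 h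
    obtain ⟨l, hl⟩ := Nat.exists_eq_succ_of_ne_zero hl
    have hne : d + p * k ≠ 0 := by
      have : 0 < p * k := Nat.mul_pos (by omega) (Nat.pos_of_ne_zero h)
      omega
    simp only [rCoeffPos, rCoeff, if_neg h, if_neg hne, digits_length_add_mul hp hd h, hl,
      Nat.succ_eq_add_one, Nat.add_sub_cancel]
    rw [pow_succ' p l, ← Nat.div_div_eq_div_mul, Nat.add_mul_div_left _ _ (by omega),
      Nat.div_eq_of_lt hd, zero_add, zero_add]
    have hp' : (p : ℝ) ≠ 0 := by positivity
    field_simp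
    ring

theorem sum_rCoeffPos_mul_pow {p : ℕ} (hp : 1 < p) (γ : ℝ) (z : ℕ) :
    ∑ d ∈ Finset.range p, (rCoeffPos p γ d : ℂ) *
        Complex.exp (2 * Real.pi * Complex.I / p) ^ (d * z) =
      ((γ * if z % p = 0 then ((p : ℝ) - 1) / (6 * p) else
        1 / 6 - ((z % p : ℕ) : ℝ) * (p - (z % p : ℕ)) / (p : ℝ) ^ 2 : ℝ) : ℂ) := by
  set ω := Complex.exp (2 * Real.pi * Complex.I / p) with hω
  have hp0 : 0 < p := by omega
  have hp' : (p : ℂ) ≠ 0 := by exact_mod_cast hp0.ne'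
  have h : ∀ d ∈ Finset.range p, (rCoeffPos p γ d : ℂ) * ω ^ (d * z) =
      γ / (2 * (p : ℂ) ^ 2) * (((1 / Real.sin (d * Real.pi / p) ^ 2 : ℝ) : ℂ) * ω ^ (d * z)
        - 1 / 3 * ω ^ (d * z) + if d = 0 then 1 / 3 else 0) := by
    intro d hd
    rw [rCoeffPos_of_lt γ (Finset.mem_range.1 hd)]
    split_ifs with h0
    · simp [h0]
    · push_cast; ring
  rw [Finset.sum_congr rfl h, ← Finset.mul_sum, Finset.sum_add_distrib, Finset.sum_sub_distrib,
    ← Finset.mul_sum, sum_rootOfUnity_pow hp0, Finset.sum_ite_eq' , if_pos (Finset.mem_range.2 hp0)]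
  have := cscSum_eq hp0 z
  rw [cscSum] at this
  rw [this]
  split_ifs with hz
  · rw [hz]; push_cast; field_simp; ring
  · push_cast; field_simp; ring

/-- The character `n ↦ exp (2 π i φ_p(k) n)` on natural numbers. -/
noncomputable def natChar (p k n : ℕ) : ℂ :=
  Complex.exp (2 * Real.pi * Complex.I * ((radicalInverse p k * (n : ℝ) : ℝ) : ℂ))

/-- The lowest digit of the index leads in the radical inverse and enters the phase as d z / p, so
summation over d is orthogonality of characters modulo p. -/
theorem sum_natChar {p : ℕ} (hp : 1 < p) (k z : ℕ) :
    ∑ d ∈ Finset.range p, natChar p (d + p * k) z =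
      if z % p = 0 then p * natChar p k (z / p) else 0 := by
  have hp' : (p : ℂ) ≠ 0 := by exact_mod_cast (by omega : p ≠ 0)
  have h : ∀ d ∈ Finset.range p, natChar p (d + p * k) z =
      Complex.exp (2 * Real.pi * Complex.I / p) ^ (d * z) *
        Complex.exp (2 * Real.pi * Complex.I * (radicalInverse p k * z / p)) := by
    intro d hd
    rw [natChar, radicalInverse_add_mul hp (Finset.mem_range.1 hd), ← Complex.exp_nat_mul,
      ← Complex.exp_add]
    congr 1
    push_cast
    field_simp
  rw [Finset.sum_congr rfl h, ← Finset.sum_mul, sum_rootOfUnity_pow (by omega)]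
  split_ifs with hz
  · congr 1
    obtain ⟨y, rfl⟩ := Nat.dvd_of_mod_eq_zero hz
    rw [natChar, Nat.mul_div_cancel_left _ (by omega)]
    congr 1
    push_cast
    field_simp
  · simp

/-- Splitting off the lowest digit of k: the indices with k = 0 above it give the one-digit sum,
while the others have coefficients independent of that digit, so `sum_natChar` removes them unless p
divides z. This is the recursion of `digitGap`. The last term is the truncation error, present only
when p^M divides z. -/
theorem sum_rCoeffPos_mul_natChar {p : ℕ} (hp : 1 < p) (γ : ℝ) (M z : ℕ) :
    ∑ k ∈ Finset.range (p ^ M), (rCoeffPos p γ k : ℂ) * natChar p k z =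
      ((γ * (1 / 6 - digitGap p M z - if z % p ^ M = 0 then 1 / (6 * (p : ℝ) ^ M) else 0) : ℝ) :
        ℂ) := by
  have hp0 : 0 < p := by omega
  have hp' : (p : ℂ) ≠ 0 := by exact_mod_cast hp0.ne'
  induction M generalizing z with
  | zero => simp [rCoeffPos, digitGap, Nat.mod_one]
  | succ M ih =>
    rw [pow_succ', sum_range_mul_eq]
    have h : ∀ k ∈ Finset.range (p ^ M), ∑ d ∈ Finset.range p,
        (rCoeffPos p γ (d + p * k) : ℂ) * natChar p (d + p * k) z =
        (if k = 0 then ∑ d ∈ Finset.range p, (rCoeffPos p γ d : ℂ) *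
          Complex.exp (2 * Real.pi * Complex.I / p) ^ (d * z) else 0) +
        (if z % p = 0 then (1 / p : ℂ) else 0) *
          ((rCoeffPos p γ k : ℂ) * natChar p k (z / p)) := by
      intro k _
      have h1 : ∀ d ∈ Finset.range p, (rCoeffPos p γ (d + p * k) : ℂ) * natChar p (d + p * k) z =
          (if k = 0 then (rCoeffPos p γ d : ℂ) *
            Complex.exp (2 * Real.pi * Complex.I / p) ^ (d * z) else 0) +
          (rCoeffPos p γ k / (p : ℂ) ^ 2) * natChar p (d + p * k) z := by
        intro d hd
        have hd := Finset.mem_range.1 hd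
        rw [rCoeffPos_add_mul hp γ hd]
        split_ifs with hk
        · have : natChar p (d + p * k) z =
              Complex.exp (2 * Real.pi * Complex.I / p) ^ (d * z) := by
            rw [hk, mul_zero, add_zero, natChar, radicalInverse_of_lt hp hd, ← Complex.exp_nat_mul]
            congr 1
            push_cast
            field_simp
          rw [this]; push_cast; ring
        · push_cast; ring
      rw [Finset.sum_congr rfl h1, Finset.sum_add_distrib, ← Finset.mul_sum, sum_natChar hp]
      congr 1
      · split_ifs <;> simp
      · split_ifs
        · field_simp
        · simp
    rw [Finset.sum_congr rfl h, Finset.sum_add_distrib, ← Finset.mul_sum, ih, Finset.sum_ite_eq',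
      if_pos (Finset.mem_range.2 (by positivity)), sum_rCoeffPos_mul_pow hp]
    by_cases hz : z % p = 0
    · obtain ⟨y, rfl⟩ := Nat.dvd_of_mod_eq_zero hz
      have hmod : (p * y % (p * p ^ M) = 0) ↔ (y % p ^ M = 0) := by
        rw [Nat.mul_mod_mul_left]
        simp [hp0.ne']
      simp only [digitGap, if_pos hz, hmod, Nat.mul_div_cancel_left _ hp0]
      split_ifs
      · push_cast; field_simp; ring
      · push_cast; field_simp; ring
    · have hmod : z % (p * p ^ M) ≠ 0 := fun h => hz (Nat.mod_eq_zero_of_dvd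
        ((Dvd.intro _ rfl).trans (Nat.dvd_of_mod_eq_zero h)))
      simp only [digitGap, if_neg hz, if_neg hmod]
      push_cast
      ring

/-! ### Residues and digits of `p`-adic integers -/

section PadicInt

variable {p : ℕ} [Fact p.Prime]

theorem appr_modEq_of_dvd_sub {M n : ℕ} {z : ℤ_[p]} (h : (p : ℤ_[p]) ^ M ∣ z - n) :
    z.appr M ≡ n [MOD p ^ M] := by
  have h1 : (p : ℤ_[p]) ^ M ∣ z - z.appr M := Ideal.mem_span_singleton.1 (z.appr_spec M)
  have h2 : (p : ℤ_[p]) ^ M ∣ (((n : ℤ) - (z.appr M : ℤ) : ℤ) : ℤ_[p]) := by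
    have := dvd_sub h1 h
    push_cast
    convert this using 1
    ring
  rw [PadicInt.pow_p_dvd_int_iff] at h2
  rw [Nat.modEq_iff_dvd]
  exact_mod_cast h2

theorem pow_dvd_sub_appr (z : ℤ_[p]) (M : ℕ) : (p : ℤ_[p]) ^ M ∣ z - z.appr M :=
  Ideal.mem_span_singleton.1 (z.appr_spec M)

theorem appr_add_modEq (x y : ℤ_[p]) (M : ℕ) :
    (x + y).appr M ≡ x.appr M + y.appr M [MOD p ^ M] := by
  refine appr_modEq_of_dvd_sub ?_
  have := dvd_add (pow_dvd_sub_appr x M) (pow_dvd_sub_appr y M)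
  push_cast
  convert this using 1
  ring

theorem appr_modEq_appr (z : ℤ_[p]) {m M : ℕ} (h : m ≤ M) :
    z.appr m ≡ z.appr M [MOD p ^ m] :=
  appr_modEq_of_dvd_sub ((pow_dvd_pow _ h).trans (pow_dvd_sub_appr z M))

theorem appr_eq_mod (z : ℤ_[p]) {m M : ℕ} (h : m ≤ M) : z.appr m = z.appr M % p ^ m := by
  rw [← appr_modEq_appr z h, Nat.mod_eq_of_lt (z.appr_lt m)]

theorem padicDigit_eq (z : ℤ_[p]) {r M : ℕ} (h : r < M) :
    padicDigit p z r = z.appr M / p ^ r % p := by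
  rw [padicDigit, appr_eq_mod z (Nat.succ_le_of_lt h), pow_succ, Nat.mod_mul_right_div_self]

theorem padicDigit_lt (z : ℤ_[p]) (r : ℕ) : padicDigit p z r < p := by
  rw [padicDigit_eq z (Nat.lt_succ_self r)]
  exact Nat.mod_lt _ (Nat.Prime.pos Fact.out)

theorem appr_succ_eq (z : ℤ_[p]) (r : ℕ) :
    z.appr (r + 1) = z.appr r + p ^ r * padicDigit p z r := by
  rw [padicDigit, appr_eq_mod z (Nat.le_succ r), Nat.mod_add_div]

theorem monnaTrunc_eq_sum {p : ℕ} (M n : ℕ) :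
    monnaTrunc p M n =
      ∑ r ∈ Finset.range M, ((n / p ^ r % p : ℕ) : ℝ) / (p : ℝ) ^ (r + 1) := by
  induction M generalizing n with
  | zero => simp [monnaTrunc]
  | succ M ih =>
    rw [monnaTrunc, ih, Finset.sum_range_succ', add_div, Finset.sum_div, add_comm]
    congr 1
    · refine Finset.sum_congr rfl fun r _ => ?_
      rw [Nat.div_div_eq_div_mul, ← pow_succ', div_div, ← pow_succ]
    · simp

theorem sum_padicDigit_div (z : ℤ_[p]) (M : ℕ) :
    ∑ r ∈ Finset.range M, (padicDigit p z r : ℝ) / (p : ℝ) ^ (r + 1) =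
      monnaTrunc p M (z.appr M) := by
  rw [monnaTrunc_eq_sum]
  exact Finset.sum_congr rfl fun r hr => by rw [padicDigit_eq z (Finset.mem_range.1 hr)]

theorem one_lt_cast_of_prime (p : ℕ) [Fact p.Prime] : (1 : ℝ) < p := by
  exact_mod_cast Nat.Prime.one_lt Fact.out

theorem hasSum_pred_div_pow (p : ℕ) [Fact p.Prime] :
    HasSum (fun r : ℕ => ((p : ℝ) - 1) / (p : ℝ) ^ (r + 1)) 1 := by
  have hp := one_lt_cast_of_prime p
  have h := (hasSum_geometric_of_lt_one (r := (p : ℝ)⁻¹) (by positivity)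
    (inv_lt_one_of_one_lt₀ hp)).mul_left (((p : ℝ) - 1) * (p : ℝ)⁻¹)
  have e : ((p : ℝ) - 1) * (p : ℝ)⁻¹ * (1 - (p : ℝ)⁻¹)⁻¹ = 1 := by
    have : (p : ℝ) - 1 ≠ 0 := by linarith
    field_simp
  rw [e] at h
  have hf : (fun r : ℕ => ((p : ℝ) - 1) / (p : ℝ) ^ (r + 1)) =
      fun r : ℕ => ((p : ℝ) - 1) * (p : ℝ)⁻¹ * (p : ℝ)⁻¹ ^ r := by
    funext r
    rw [pow_succ', inv_pow]
    field_simp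
  rwa [hf]

theorem padicDigit_div_le (z : ℤ_[p]) (r : ℕ) :
    (padicDigit p z r : ℝ) / (p : ℝ) ^ (r + 1) ≤ ((p : ℝ) - 1) / (p : ℝ) ^ (r + 1) := by
  have h : (padicDigit p z r : ℝ) + 1 ≤ p := by exact_mod_cast padicDigit_lt z r
  gcongr
  linarith

theorem summable_padicDigit_div (z : ℤ_[p]) :
    Summable fun r : ℕ => (padicDigit p z r : ℝ) / (p : ℝ) ^ (r + 1) :=
  Summable.of_nonneg_of_le (fun _ => by positivity) (padicDigit_div_le z)
    (hasSum_pred_div_pow p).summable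

theorem tendsto_monnaTrunc_appr (z : ℤ_[p]) :
    Tendsto (fun M => monnaTrunc p M (z.appr M)) atTop
      (𝓝 (∑' r : ℕ, (padicDigit p z r : ℝ) / (p : ℝ) ^ (r + 1))) := by
  simpa only [sum_padicDigit_div] using (summable_padicDigit_div z).hasSum.tendsto_sum_nat

/-- Here z + 1 is divisible by every p^M. Since the digit series reaches 1 only when all digits are
p - 1, the reduction modulo 1 in `monna` acts only at z = -1. -/
theorem eq_neg_one_of_forall_padicDigit {z : ℤ_[p]} (h : ∀ r, padicDigit p z r + 1 = p) :
    z = -1 := by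
  have hz : ∀ M, z.appr M + 1 = p ^ M := by
    intro M
    induction M with
    | zero => simp [PadicInt.appr]
    | succ M ih =>
      rw [appr_succ_eq, pow_succ]
      have := congrArg (fun t => p ^ M * t) (h M)
      simp only [mul_add] at this
      linarith
  refine PadicInt.ext_of_toZModPow.1 fun n => ?_
  have h1 : (PadicInt.toZModPow n z : ZMod (p ^ n)) = (z.appr n : ZMod (p ^ n)) := rfl
  have h2 : ((z.appr n + 1 : ℕ) : ZMod (p ^ n)) = 0 := by
    rw [hz n, ZMod.natCast_self]
  rw [h1, map_neg, map_one]
  push_cast at h2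
  exact eq_neg_of_add_eq_zero_left h2

theorem tsum_padicDigit_lt_one {z : ℤ_[p]} (hz : z ≠ -1) :
    ∑' r : ℕ, (padicDigit p z r : ℝ) / (p : ℝ) ^ (r + 1) < 1 := by
  have hp := one_lt_cast_of_prime p
  obtain ⟨r, hr⟩ : ∃ r, padicDigit p z r + 1 ≠ p := by
    by_contra! h
    exact hz (eq_neg_one_of_forall_padicDigit h)
  have hlt : padicDigit p z r + 1 < p := lt_of_le_of_ne (padicDigit_lt z r) hr
  have hlt' : (padicDigit p z r : ℝ) + 1 < p := by exact_mod_cast hlt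
  refine hasSum_lt (padicDigit_div_le z) (i := r) ?_ (summable_padicDigit_div z).hasSum
    (hasSum_pred_div_pow p)
  gcongr
  linarith

theorem monna_eq_tsum {z : ℤ_[p]} (hz : z ≠ -1) :
    monna p z = ∑' r : ℕ, (padicDigit p z r : ℝ) / (p : ℝ) ^ (r + 1) :=
  Int.fract_eq_self.2 ⟨tsum_nonneg fun _ => by positivity, tsum_padicDigit_lt_one hz⟩

/-! ### The inverse of the Monna map -/

theorem appr_monnaInv_modEq (x : ℝ) (M : ℕ) :
    (monnaInv p x).appr M ≡ ∑ r ∈ Finset.range M, (Real.digits x p r : ℕ) * p ^ r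
      [MOD p ^ M] := by
  refine appr_modEq_of_dvd_sub ?_
  have hp := one_lt_cast_of_prime p
  have hs : Summable fun r : ℕ => ((Real.digits x p r : ℕ) : ℤ_[p]) * (p : ℤ_[p]) ^ r := by
    refine Summable.of_norm_bounded (g := fun r : ℕ => ((p : ℝ)⁻¹) ^ r)
      (summable_geometric_of_lt_one (by positivity) (inv_lt_one_of_one_lt₀ hp)) fun r => ?_
    rw [norm_mul, norm_pow, PadicInt.norm_p]
    exact mul_le_of_le_one_left (by positivity) (PadicInt.norm_le_one _)
  rw [monnaInv, ← hs.sum_add_tsum_nat_add M]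
  push_cast
  rw [add_sub_cancel_left]
  have hs' : Summable fun r : ℕ =>
      ((Real.digits x p (r + M) : ℕ) : ℤ_[p]) * (p : ℤ_[p]) ^ r := by
    refine Summable.of_norm_bounded (g := fun r : ℕ => ((p : ℝ)⁻¹) ^ r)
      (summable_geometric_of_lt_one (by positivity) (inv_lt_one_of_one_lt₀ hp)) fun r => ?_
    rw [norm_mul, norm_pow, PadicInt.norm_p]
    exact mul_le_of_le_one_left (by positivity) (PadicInt.norm_le_one _)
  refine Dvd.intro (∑' r : ℕ, ((Real.digits x p (r + M) : ℕ) : ℤ_[p]) * (p : ℤ_[p]) ^ r) ?_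
  rw [← hs'.tsum_mul_left]
  exact tsum_congr fun r => by ring

theorem sum_digits_mul_pow_lt (p : ℕ) [NeZero p] (x : ℝ) (M : ℕ) :
    ∑ r ∈ Finset.range M, (Real.digits x p r : ℕ) * p ^ r < p ^ M := by
  induction M with
  | zero => simp
  | succ M ih =>
    rw [Finset.sum_range_succ, pow_succ']
    have h : (Real.digits x p M : ℕ) + 1 ≤ p := (Real.digits x p M).2
    have := Nat.mul_le_mul_right (p ^ M) h
    linarith

theorem appr_monnaInv (x : ℝ) (M : ℕ) :
    (monnaInv p x).appr M = ∑ r ∈ Finset.range M, (Real.digits x p r : ℕ) * p ^ r := by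
  have := appr_monnaInv_modEq (p := p) x M
  rwa [Nat.ModEq, Nat.mod_eq_of_lt (PadicInt.appr_lt _ _),
    Nat.mod_eq_of_lt (sum_digits_mul_pow_lt p x M)] at this

theorem monnaInv_injOn : Set.InjOn (monnaInv p) (Set.Ico 0 1) := by
  intro x hx y hy h
  have hp1 : 1 < p := Nat.Prime.one_lt Fact.out
  have hd : Real.digits x p = Real.digits y p := by
    funext r
    have h1 := congrArg (fun z => z.appr r) h
    have h2 := congrArg (fun z => z.appr (r + 1)) h
    simp only [appr_monnaInv, Finset.sum_range_succ] at h1 h2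
    rw [h1] at h2
    exact Fin.ext (Nat.eq_of_mul_eq_mul_right (pow_pos (by omega) r) (Nat.add_left_cancel h2))
  rw [← Real.ofDigits_digits hp1 hx, hd, Real.ofDigits_digits hp1 hy]

/-- The number whose `M` lowest base `p` digits are those of `i` in reverse order. -/
def digitRev (p : ℕ) : ℕ → ℕ → ℕ
  | 0, _ => 0
  | M + 1, i => digitRev p M (i / p) + i % p * p ^ M

/-- The first M digits of x are those of ⌊x p^M⌋, but `monnaInv` reads them with the first one least
significant. -/
theorem sum_digits_mul_pow {x : ℝ} (M : ℕ) :
    ∑ r ∈ Finset.range M, (Real.digits x p r : ℕ) * p ^ r = digitRev p M ⌊x * (p : ℝ) ^ M⌋₊ := by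
  induction M with
  | zero => simp [digitRev]
  | succ M ih =>
    have hp : (p : ℝ) ≠ 0 := by have := one_lt_cast_of_prime p; positivity
    have h : ⌊x * (p : ℝ) ^ (M + 1)⌋₊ / p = ⌊x * (p : ℝ) ^ M⌋₊ := by
      rw [← Nat.floor_div_natCast, pow_succ, ← mul_assoc, mul_div_cancel_right₀ _ hp]
    rw [Finset.sum_range_succ, ih, digitRev, h]
    rfl

/-- Digit reversal permutes the residues modulo p^M: the lowest digit is split off on one side and
the highest on the other. Hence a uniform σ gives a uniform residue of φ_p⁺(σ). -/
theorem sum_digitRev (p M : ℕ) (f : ℕ → ℝ) :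
    ∑ i ∈ Finset.range (p ^ M), f (digitRev p M i) = ∑ n ∈ Finset.range (p ^ M), f n := by
  induction M generalizing f with
  | zero => simp [digitRev]
  | succ M ih =>
    rw [pow_succ', sum_range_mul_eq, Finset.sum_comm, mul_comm, sum_range_mul_eq]
    refine Finset.sum_congr rfl fun d hd => ?_
    have hd := Finset.mem_range.1 hd
    rw [← ih fun n => f (n + p ^ M * d)]
    refine Finset.sum_congr rfl fun i _ => ?_
    rw [digitRev, Nat.add_mul_mod_self_left, Nat.mod_eq_of_lt hd,
      Nat.add_mul_div_left _ _ (by omega), Nat.div_eq_of_lt hd, zero_add, mul_comm d]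

/-! ### Averages over the shift -/

theorem integral_floor_mul {n : ℕ} (hn : 0 < n) (F : ℕ → ℝ) :
    ∫ σ in Set.Ico (0 : ℝ) 1, F ⌊σ * n⌋₊ = (∑ i ∈ Finset.range n, F i) / n := by
  have hn' : (0 : ℝ) < n := by exact_mod_cast hn
  have h : ∀ σ ∈ Set.Ico (0 : ℝ) 1, F ⌊σ * n⌋₊ = ∑ i ∈ Finset.range n,
      (Set.Ico ((i : ℝ) / n) ((i + 1) / n)).indicator (fun _ => F i) σ := by
    intro σ hσ
    have h0 : 0 ≤ σ * n := mul_nonneg hσ.1 hn'.le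
    have hmem : ∀ i : ℕ, σ ∈ Set.Ico ((i : ℝ) / n) ((i + 1) / n) ↔ i = ⌊σ * n⌋₊ := by
      intro i
      rw [Set.mem_Ico, div_le_iff₀ hn', lt_div_iff₀ hn', eq_comm, Nat.floor_eq_iff h0]
    simp only [Set.indicator_apply, hmem]
    rw [Finset.sum_ite_eq' , if_pos]
    rw [Finset.mem_range, Nat.floor_lt h0]
    nlinarith [hσ.2]
  rw [setIntegral_congr_fun measurableSet_Ico h, integral_finsetSum]
  · rw [Finset.sum_div]
    refine Finset.sum_congr rfl fun i hi => ?_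
    have hi' : (i : ℝ) + 1 ≤ n := by exact_mod_cast Finset.mem_range.1 hi
    have hsub : Set.Ico ((i : ℝ) / n) ((i + 1) / n) ⊆ Set.Ico 0 1 :=
      Set.Ico_subset_Ico (by positivity) ((div_le_one hn').2 hi')
    rw [integral_indicator measurableSet_Ico, Measure.restrict_restrict measurableSet_Ico,
      Set.inter_eq_left.2 hsub]
    simp only [integral_const, MeasurableSet.univ, measureReal_restrict_apply, Set.univ_inter,
      Real.volume_real_Ico, smul_eq_mul]
    rw [max_eq_left (by rw [sub_nonneg]; gcongr; linarith)]
    ring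
  · intro i _
    exact (integrable_const _).indicator measurableSet_Ico

/-- Injectivity of φ_p⁺ leaves at most one exceptional σ. With w = -1 this avoids the point where
`monna` differs from its digit series. -/
theorem ae_shift_ne (x w : ℤ_[p]) :
    ∀ᵐ σ ∂volume.restrict (Set.Ico (0 : ℝ) 1), x + monnaInv p σ ≠ w := by
  rw [ae_restrict_iff' measurableSet_Ico, ae_iff]
  refine Set.Subsingleton.measure_zero ?_ _
  intro σ hσ τ hτ
  simp only [Set.mem_ofPred_eq, Classical.not_imp, not_not, ne_eq] at hσ hτ
  exact monnaInv_injOn hσ.1 hτ.1 (add_left_cancel (hσ.2.trans hτ.2.symm))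

theorem ae_tendsto_monna (x : ℤ_[p]) :
    ∀ᵐ σ ∂volume.restrict (Set.Ico (0 : ℝ) 1),
      Tendsto (fun M => monnaTrunc p M (x.appr M + digitRev p M ⌊σ * ((p ^ M : ℕ) : ℝ)⌋₊)) atTop
        (𝓝 (monna p (x + monnaInv p σ))) := by
  filter_upwards [ae_shift_ne x (-1)] with σ hσ
  rw [monna_eq_tsum hσ]
  refine (tendsto_monnaTrunc_appr _).congr fun M => ?_
  push_cast
  rw [← sum_digits_mul_pow, ← appr_monnaInv]
  exact monnaTrunc_congr (Nat.Prime.pos Fact.out) (appr_add_modEq _ _ _)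

theorem measurable_comp_floor_mul (F : ℕ → ℝ) (c : ℝ) : Measurable fun σ : ℝ => F ⌊σ * c⌋₊ :=
  (measurable_from_nat (f := F)).comp (Nat.measurable_floor.comp (measurable_id.mul_const c))

theorem aestronglyMeasurable_monna_shift (x : ℤ_[p]) :
    AEStronglyMeasurable (fun σ => monna p (x + monnaInv p σ))
      (volume.restrict (Set.Ico (0 : ℝ) 1)) :=
  aestronglyMeasurable_of_tendsto_ae atTop
    (fun M => (measurable_comp_floor_mul (fun i => monnaTrunc p M (x.appr M + digitRev p M i))
      ((p ^ M : ℕ) : ℝ)).aestronglyMeasurable) (ae_tendsto_monna x)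

/-- The average over residues is the integral over σ of a step function at level M. These converge
almost everywhere and are dominated by a bound of G on the unit square. -/
theorem tendsto_average_shift (x y : ℤ_[p]) {G : ℝ × ℝ → ℝ} (hG : Continuous G) :
    Tendsto (fun M => (∑ n ∈ Finset.range (p ^ M), G (monnaTrunc p M (x.appr M + n),
        monnaTrunc p M (y.appr M + n))) / ((p ^ M : ℕ) : ℝ)) atTop
      (𝓝 (∫ σ in Set.Ico (0 : ℝ) 1, G (monna p (x + monnaInv p σ), monna p (y + monnaInv p σ)))) := by
  have hp : 0 < p := Nat.Prime.pos Fact.out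
  obtain ⟨C, hC⟩ := (isCompact_Icc (a := ((0 : ℝ), (0 : ℝ))) (b := (1, 1))).exists_bound_of_continuousOn
    hG.continuousOn
  let F : ℕ → ℕ → ℝ := fun M n => G (monnaTrunc p M (x.appr M + n), monnaTrunc p M (y.appr M + n))
  have hF : ∀ M, ∫ σ in Set.Ico (0 : ℝ) 1, F M (digitRev p M ⌊σ * ((p ^ M : ℕ) : ℝ)⌋₊) =
      (∑ n ∈ Finset.range (p ^ M), F M n) / ((p ^ M : ℕ) : ℝ) := fun M => by
    rw [integral_floor_mul (pow_pos hp M) fun i => F M (digitRev p M i), sum_digitRev]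
  refine Tendsto.congr hF ?_
  refine tendsto_integral_of_dominated_convergence (fun _ => C) (fun M => ?_)
    (integrable_const _) (fun M => Eventually.of_forall fun σ => ?_) ?_
  · exact (measurable_comp_floor_mul (fun i => F M (digitRev p M i)) _).aestronglyMeasurable
  · exact hC _ ⟨⟨monnaTrunc_nonneg _ _ _, monnaTrunc_nonneg _ _ _⟩,
      ⟨(monnaTrunc_lt_one hp _ _).le, (monnaTrunc_lt_one hp _ _).le⟩⟩
  · filter_upwards [ae_tendsto_monna x, ae_tendsto_monna y] with σ hx hy
    exact (hG.tendsto _).comp (hx.prodMk_nhds hy)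

theorem tendsto_inv_pow_atTop (p : ℕ) [Fact p.Prime] :
    Tendsto (fun M : ℕ => ((p : ℝ) ^ M)⁻¹) atTop (𝓝 0) :=
  tendsto_inv_atTop_zero.comp (tendsto_pow_atTop_atTop_of_one_lt (one_lt_cast_of_prime p))

theorem integral_monna_shift_sq (x : ℤ_[p]) :
    ∫ σ in Set.Ico (0 : ℝ) 1, monna p (x + monnaInv p σ) ^ 2 = 1 / 3 := by
  have hp : 0 < p := Nat.Prime.pos Fact.out
  have h := tendsto_average_shift x x (G := fun t => t.1 ^ 2) (by fun_prop)
  refine tendsto_nhds_unique h ?_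
  have hlim : Tendsto (fun M : ℕ => (1 - ((p : ℝ) ^ M)⁻¹) * (2 - ((p : ℝ) ^ M)⁻¹) / 6) atTop
      (𝓝 ((1 - 0) * (2 - 0) / 6)) :=
    ((tendsto_const_nhds.sub (tendsto_inv_pow_atTop p)).mul
      (tendsto_const_nhds.sub (tendsto_inv_pow_atTop p))).div_const 6
  rw [show (1 : ℝ) / 3 = (1 - 0) * (2 - 0) / 6 by norm_num]
  refine hlim.congr fun M => ?_
  have hs := sum_range_add_of_periodic (fun n => monnaTrunc p M n ^ 2) (p ^ M)
    (fun n => by rw [monnaTrunc_add_pow hp]) (x.appr M)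
  simp only [add_comm _ (x.appr M)] at hs
  rw [hs, sum_monnaTrunc_sq hp]
  have : (p : ℝ) ≠ 0 := by positivity
  push_cast
  field_simp

/-- Translating the residues by that of x, which periodicity allows, turns the pair of arguments
into n and n + (y - x), so `sum_max_monnaTrunc` applies at every level. -/
theorem tendsto_digitGap (x y : ℤ_[p]) :
    Tendsto (fun M => digitGap p M ((y - x).appr M)) atTop
      (𝓝 ((∫ σ in Set.Ico (0 : ℝ) 1,
        max (monna p (x + monnaInv p σ)) (monna p (y + monnaInv p σ))) - 1 / 2)) := by
  have hp : 0 < p := Nat.Prime.pos Fact.out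
  have hp' : (p : ℝ) ≠ 0 := by positivity
  have h := tendsto_average_shift x y (G := fun t => max t.1 t.2) (by fun_prop)
  have h2 := (h.sub (((tendsto_const_nhds (x := (1 : ℝ))).sub
    (tendsto_inv_pow_atTop p)).div_const 2))
  rw [sub_zero] at h2
  refine h2.congr fun M => ?_
  have hxy : ∀ n, monnaTrunc p M (y.appr M + n) =
      monnaTrunc p M (n + x.appr M + (y - x).appr M) := by
    intro n
    refine monnaTrunc_congr hp ?_
    have := appr_add_modEq x (y - x) M
    rw [add_sub_cancel] at this
    rw [add_assoc, add_comm n]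
    exact this.add_right n
  have hs := sum_range_add_of_periodic
    (fun n => max (monnaTrunc p M n) (monnaTrunc p M (n + (y - x).appr M))) (p ^ M)
    (fun n => by rw [monnaTrunc_add_pow hp, add_right_comm, monnaTrunc_add_pow hp]) (x.appr M)
  simp only [hxy, add_comm (x.appr M)]
  rw [hs, sum_max_monnaTrunc hp]
  push_cast
  field_simp
  ring

/-! ### The `p`-adic characters -/

theorem exists_radicalInverse_mul_pow {p : ℕ} (hp : 0 < p) (k : ℕ) :
    ∃ c : ℕ, radicalInverse p k * (p : ℝ) ^ (Nat.digits p k).length = c := by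
  refine ⟨∑ r ∈ Finset.range (Nat.digits p k).length,
    (k / p ^ r % p) * p ^ ((Nat.digits p k).length - (r + 1)), ?_⟩
  have hp' : (p : ℝ) ≠ 0 := by positivity
  rw [radicalInverse, Finset.sum_mul]
  push_cast
  refine Finset.sum_congr rfl fun r hr => ?_
  have hr := Finset.mem_range.1 hr
  rw [div_mul_eq_mul_div, mul_div_assoc, pow_sub₀ _ hp' (by omega), div_eq_mul_inv]

theorem natChar_add (p k m n : ℕ) : natChar p k (m + n) = natChar p k m * natChar p k n := by
  rw [natChar, natChar, natChar, ← Complex.exp_add]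
  congr 1
  push_cast
  ring

theorem natChar_pow_mul {p : ℕ} (hp : 0 < p) (k t : ℕ) :
    natChar p k (p ^ (Nat.digits p k).length * t) = 1 := by
  obtain ⟨c, hc⟩ := exists_radicalInverse_mul_pow hp k
  rw [natChar, Complex.exp_eq_one_iff]
  refine ⟨c * t, ?_⟩
  push_cast
  have : ((radicalInverse p k : ℂ)) * (p : ℂ) ^ (Nat.digits p k).length = c := by
    exact_mod_cast congrArg Complex.ofReal hc
  linear_combination 2 * Real.pi * Complex.I * t * this

theorem natChar_congr {p : ℕ} (hp : 0 < p) {k m n : ℕ}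
    (h : m ≡ n [MOD p ^ (Nat.digits p k).length]) : natChar p k m = natChar p k n := by
  have key : ∀ m, natChar p k m = natChar p k (m % p ^ (Nat.digits p k).length) := fun m => by
    conv_lhs => rw [← Nat.mod_add_div m (p ^ (Nat.digits p k).length), natChar_add,
      natChar_pow_mul hp, mul_one]
  rw [key m, key n, h]

theorem norm_natChar (p k n : ℕ) : ‖natChar p k n‖ = 1 := by
  rw [natChar, show (2 * Real.pi * Complex.I * ((radicalInverse p k * (n : ℝ) : ℝ) : ℂ)) =
    ((2 * Real.pi * (radicalInverse p k * (n : ℝ)) : ℝ) : ℂ) * Complex.I by push_cast; ring]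
  exact Complex.norm_exp_ofReal_mul_I _

theorem padicChar_eq_natChar {k M : ℕ} (h : k < p ^ M) (z : ℤ_[p]) :
    padicChar p k z = natChar p k (z.appr M) := by
  have hp : 1 < p := Nat.Prime.one_lt Fact.out
  have hl : (Nat.digits p k).length ≤ M := (Nat.digits_length_le_iff hp k).2 h
  exact natChar_congr (by omega) (appr_modEq_appr z hl)

theorem norm_padicChar (k : ℕ) (z : ℤ_[p]) : ‖padicChar p k z‖ = 1 :=
  norm_natChar _ _ _

theorem padicChar_sub (k : ℕ) (y x : ℤ_[p]) :
    padicChar p k (y - x) = padicChar p k y * starRingEnd ℂ (padicChar p k x) := by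
  have hp : 0 < p := Nat.Prime.pos Fact.out
  have h1 : padicChar p k x * padicChar p k (y - x) = padicChar p k y := by
    have h := appr_add_modEq x (y - x) (Nat.digits p k).length
    rw [add_sub_cancel] at h
    change natChar p k _ * natChar p k _ = natChar p k _
    rw [← natChar_add]
    exact (natChar_congr hp h).symm
  have h2 : padicChar p k x * starRingEnd ℂ (padicChar p k x) = 1 := by
    rw [Complex.mul_conj, Complex.normSq_eq_norm_sq, norm_padicChar]; simp
  linear_combination starRingEnd ℂ (padicChar p k x) * h1 - padicChar p k (y - x) * h2

theorem padicChar_zero (z : ℤ_[p]) : padicChar p 0 z = 1 := by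
  simp [padicChar, radicalInverse]

/-! ### The Fourier expansion of the averaged kernel -/

theorem digitGap_zero (p M : ℕ) : digitGap p M 0 = 0 := by
  induction M with
  | zero => rfl
  | succ M ih => simp [digitGap, ih]

/-- The leading digit lies strictly between 0 and p, so the sine is nonzero and 1 / sin² ≥ 1 > 1/3.
-/
theorem rCoeffPos_nonneg {p : ℕ} {γ : ℝ} (hγ : 0 ≤ γ) (k : ℕ) (hp : 1 < p) : 0 ≤ rCoeffPos p γ k := by
  by_cases h : k = 0
  · simp [rCoeffPos, h]
  · rw [rCoeffPos, if_neg h, rCoeff, if_neg h]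
    refine mul_nonneg (by positivity) ?_
    have hl : (Nat.digits p k).length ≠ 0 := by
      rw [Ne, List.length_eq_zero_iff]
      exact Nat.digits_ne_nil_iff_ne_zero.2 h
    have h1 : p ^ ((Nat.digits p k).length - 1) ≤ k := by
      rw [← Nat.lt_digits_length_iff hp]
      omega
    have h2 : k < p * p ^ ((Nat.digits p k).length - 1) := by
      rw [← pow_succ', Nat.sub_add_cancel (by omega)]
      exact Nat.lt_base_pow_length_digits hp
    set q := p ^ ((Nat.digits p k).length - 1)
    have hq : 0 < q := by positivity
    have h3 := sin_natCast_mul_pi_div_ne_zero (p := p) (k := k / q) (Nat.div_pos h1 hq).ne'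
      ((Nat.div_lt_iff_lt_mul hq).2 h2)
    have h4 := Real.sin_sq_le_one ((k / q : ℕ) * Real.pi / p)
    have h5 : 1 ≤ 1 / Real.sin ((k / q : ℕ) * Real.pi / p) ^ 2 :=
      (one_le_div (by positivity)).2 h4
    linarith

/-- At z = 0 all characters equal 1, so the finite Fourier sum bounds the partial sums of these
nonnegative coefficients by γ/6. -/
theorem summable_rCoeffPos {p : ℕ} (hp : 1 < p) {γ : ℝ} (hγ : 0 ≤ γ) :
    Summable (rCoeffPos p γ) := by
  refine summable_of_sum_range_le (c := γ / 6) (fun k => rCoeffPos_nonneg hγ k hp) fun n => ?_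
  have h1 : ∑ k ∈ Finset.range n, rCoeffPos p γ k ≤ ∑ k ∈ Finset.range (p ^ n), rCoeffPos p γ k :=
    Finset.sum_le_sum_of_subset_of_nonneg
      (Finset.range_subset_range.2 (Nat.lt_pow_self hp).le) fun k _ _ => rCoeffPos_nonneg hγ k hp
  refine h1.trans ?_
  have h2 := sum_rCoeffPos_mul_natChar hp γ n 0
  simp only [natChar, Nat.cast_zero, mul_zero, Complex.ofReal_zero, Complex.exp_zero, mul_one,
    digitGap_zero, Nat.zero_mod, if_true] at h2
  have h3 : ∑ k ∈ Finset.range (p ^ n), rCoeffPos p γ k =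
    γ * (1 / 6 - 0 - 1 / (6 * (p : ℝ) ^ n)) := by exact_mod_cast h2
  rw [h3]
  have : 0 ≤ γ * (1 / (6 * (p : ℝ) ^ n)) := by positivity
  linarith

theorem summable_rCoeff {p : ℕ} (hp : 1 < p) {γ : ℝ} (hγ : 0 ≤ γ) : Summable (rCoeff p γ) := by
  refine (summable_nat_add_iff 1).1 (((summable_nat_add_iff 1).2 (summable_rCoeffPos hp hγ)).congr
    fun k => ?_)
  simp [rCoeffPos]

theorem hasSum_rCoeff_mul_padicChar {γ : ℝ} (hγ : 0 ≤ γ) (x y : ℤ_[p]) :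
    HasSum (fun k => (rCoeff p γ k : ℂ) *
        (padicChar p k y * starRingEnd ℂ (padicChar p k x)))
      ((∫ σ in Set.Ico (0 : ℝ) 1, (1 + γ * min (1 - monna p (x + monnaInv p σ))
        (1 - monna p (y + monnaInv p σ))) : ℝ) : ℂ) := by
  have hp : 1 < p := Nat.Prime.one_lt Fact.out
  set I := ∫ σ in Set.Ico (0 : ℝ) 1, max (monna p (x + monnaInv p σ)) (monna p (y + monnaInv p σ))
    with hI
  have hint : Integrable (fun σ => max (monna p (x + monnaInv p σ)) (monna p (y + monnaInv p σ)))
      (volume.restrict (Set.Ico (0 : ℝ) 1)) := by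
    refine Integrable.of_bound (C := 1) ((aestronglyMeasurable_monna_shift x).sup
      (aestronglyMeasurable_monna_shift y)) (Eventually.of_forall fun σ => ?_)
    rw [Real.norm_of_nonneg (le_max_of_le_left (monna_mem_unitInterval _ _).1)]
    exact max_le (monna_mem_unitInterval _ _).2 (monna_mem_unitInterval _ _).2
  have hval : ∫ σ in Set.Ico (0 : ℝ) 1, (1 + γ * min (1 - monna p (x + monnaInv p σ))
      (1 - monna p (y + monnaInv p σ))) = 1 + γ / 3 + γ * (2 / 3 - I) := by
    have h : ∀ σ, 1 + γ * min (1 - monna p (x + monnaInv p σ)) (1 - monna p (y + monnaInv p σ)) =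
        1 + γ - γ * max (monna p (x + monnaInv p σ)) (monna p (y + monnaInv p σ)) := by
      intro σ
      rw [min_sub_sub_left]
      ring
    simp only [h]
    rw [integral_sub (integrable_const _) (hint.const_mul γ), integral_const_mul, ← hI]
    simp
    ring
  rw [hval]
  set f : ℕ → ℂ := fun k => (rCoeffPos p γ k : ℂ) * padicChar p k (y - x) with hf
  have hsum : Summable f := by
    refine Summable.of_norm ((summable_rCoeffPos hp hγ).congr fun k => ?_)
    rw [hf, norm_mul, norm_padicChar, mul_one, Complex.norm_real,
      Real.norm_of_nonneg (rCoeffPos_nonneg hγ k hp)]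
  have hlim : Tendsto (fun M : ℕ => ∑ k ∈ Finset.range (p ^ M), f k) atTop
      (𝓝 ((γ * (2 / 3 - I) : ℝ) : ℂ)) := by
    have h1 : ∀ M : ℕ, ∑ k ∈ Finset.range (p ^ M), f k = ((γ * (1 / 6 - digitGap p M ((y - x).appr M)
        - if (y - x).appr M % p ^ M = 0 then 1 / (6 * (p : ℝ) ^ M) else 0) : ℝ) : ℂ) := by
      intro M
      rw [← sum_rCoeffPos_mul_natChar hp]
      exact Finset.sum_congr rfl fun k hk => by
        simp only [hf, padicChar_eq_natChar (Finset.mem_range.1 hk)]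
    have h2 : Tendsto (fun M : ℕ => if (y - x).appr M % p ^ M = 0 then 1 / (6 * (p : ℝ) ^ M) else 0)
        atTop (𝓝 0) := by
      refine squeeze_zero (fun M => ?_) (fun M => ?_) (tendsto_inv_pow_atTop p)
      · split_ifs <;> positivity
      · have : 0 < (p : ℝ) ^ M := by positivity
        split_ifs
        · rw [← one_div]
          gcongr
          linarith
        · positivity
    have h3 := ((tendsto_const_nhds (x := (1 / 6 : ℝ))).sub (tendsto_digitGap x y)).sub h2
    have h4 := (Complex.continuous_ofReal.tendsto _).comp (h3.const_mul γ)
    rw [show γ * (2 / 3 - I) = γ * (1 / 6 - (I - 1 / 2) - 0) by ring]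
    exact h4.congr fun M => (h1 M).symm
  -- Absolute summability identifies the full sum with the limit along the partial sums of length
  -- p^M.
  have htsum : HasSum f ((γ * (2 / 3 - I) : ℝ) : ℂ) := by
    have h5 := hsum.hasSum.tendsto_sum_nat.comp (tendsto_pow_atTop_atTop_of_one_lt hp)
    rw [← tendsto_nhds_unique h5 hlim]
    exact hsum.hasSum
  have h0 := (hasSum_ite_eq (0 : ℕ) ((1 + γ / 3 : ℝ) : ℂ)).add htsum
  convert h0 using 1
  · funext k
    rw [← padicChar_sub]
    by_cases hk : k = 0
    · simp [hk, hf, rCoeffPos, rCoeff, padicChar_zero]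
    · simp [hk, hf, rCoeffPos]
  · push_cast
    ring

end PadicInt

/-! ### The reproducing kernel -/

theorem integral_unitInterval_eq (g : ℝ → ℝ) :
    ∫ t : unitInterval, g t = ∫ t in (0 : ℝ)..1, g t := by
  rw [unitInterval.measurePreserving_coe.integral_comp unitInterval.measurableEmbedding_coe g,
    intervalIntegral.integral_of_le zero_le_one, ← integral_Icc_eq_integral_Ioc]

theorem integral_min_one_sub (γ : ℝ) (y : unitInterval) :
    ∫ t : unitInterval, (1 + γ * min (1 - (t : ℝ)) (1 - (y : ℝ))) =
      1 + γ * ((1 - (y : ℝ) ^ 2) / 2) := by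
  rw [integral_unitInterval_eq fun t => 1 + γ * min (1 - t) (1 - (y : ℝ))]
  have hc : Continuous fun t : ℝ => 1 + γ * min (1 - t) (1 - (y : ℝ)) := by fun_prop
  rw [← intervalIntegral.integral_add_adjacent_intervals (hc.intervalIntegrable 0 y)
    (hc.intervalIntegrable y 1)]
  have h1 : ∫ t in (0 : ℝ)..y, (1 + γ * min (1 - t) (1 - (y : ℝ))) =
      ∫ t in (0 : ℝ)..y, (1 + γ * (1 - (y : ℝ))) := by
    refine intervalIntegral.integral_congr fun t ht => ?_
    rw [Set.uIcc_of_le y.2.1] at ht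
    rw [min_eq_right (by linarith [ht.2])]
  have h2 : ∫ t in (y : ℝ)..1, (1 + γ * min (1 - t) (1 - (y : ℝ))) =
      ∫ t in (y : ℝ)..1, ((1 + γ) - γ * t) := by
    refine intervalIntegral.integral_congr fun t ht => ?_
    rw [Set.uIcc_of_le y.2.2] at ht
    rw [min_eq_left (by linarith [ht.1])]
    ring
  rw [h1, h2, intervalIntegral.integral_sub (by simp) (by
    exact (continuous_const.mul continuous_id).intervalIntegrable _ _),
    intervalIntegral.integral_const_mul, integral_id]
  simp
  ring

theorem integral_one_sub_sq (γ : ℝ) :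
    ∫ t : unitInterval, (1 + γ * ((1 - (t : ℝ) ^ 2) / 2)) = 1 + γ / 3 := by
  rw [integral_unitInterval_eq fun t => 1 + γ * ((1 - t ^ 2) / 2)]
  have h : ∀ t : ℝ, 1 + γ * ((1 - t ^ 2) / 2) = (1 + γ / 2) - γ / 2 * t ^ 2 := fun t => by ring
  simp only [h]
  rw [intervalIntegral.integral_sub (by simp) (by
    exact (continuous_const.mul (continuous_pow 2)).intervalIntegrable _ _),
    intervalIntegral.integral_const_mul, integral_pow]
  simp
  ring

/-! ### The representer of the error functional -/

section Kernel

variable {s : ℕ} (γ : Fin s → {g : ℝ // 0 < g})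

/-- The integral of the kernel `K(x, y)` over `x`. -/
noncomputable def sobolevKernelMean (y : UnitCube s) : ℝ :=
  ∏ j, (1 + (γ j : ℝ) * ((1 - (y j : ℝ) ^ 2) / 2))

theorem continuous_sobolevKernel :
    Continuous fun t : UnitCube s × UnitCube s => sobolevKernel γ t.1 t.2 := by
  unfold sobolevKernel
  fun_prop

theorem continuous_sobolevKernelMean : Continuous (sobolevKernelMean γ) := by
  unfold sobolevKernelMean
  fun_prop

theorem sobolevKernel_comm (x y : UnitCube s) : sobolevKernel γ x y = sobolevKernel γ y x := by
  simp only [sobolevKernel, min_comm]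

theorem integral_sobolevKernel (y : UnitCube s) :
    ∫ x, sobolevKernel γ x y = sobolevKernelMean γ y := by
  unfold sobolevKernel sobolevKernelMean
  rw [integral_fintype_prod_volume_eq_prod
    (fun j (t : unitInterval) => 1 + (γ j : ℝ) * min (1 - (t : ℝ)) (1 - (y j : ℝ)))]
  exact Finset.prod_congr rfl fun j _ => integral_min_one_sub _ _

theorem integral_sobolevKernelMean :
    ∫ y, sobolevKernelMean γ y = ∏ j, (1 + (γ j : ℝ) / 3) := by
  unfold sobolevKernelMean
  rw [integral_fintype_prod_volume_eq_prod
    (fun j (t : unitInterval) => 1 + (γ j : ℝ) * ((1 - (t : ℝ) ^ 2) / 2))]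
  exact Finset.prod_congr rfl fun j _ => integral_one_sub_sq _

/-- The function `K(·, x)` as an element of the space. -/
noncomputable def kernelSection (x : UnitCube s) : AnchoredSobolev γ :=
  RKHS.kerFun (AnchoredSobolev γ) x 1

theorem inner_kernelSection (f : AnchoredSobolev γ) (x : UnitCube s) :
    inner ℝ f (kernelSection γ x) = f x := by
  rw [kernelSection, RKHS.inner_kerFun]
  simp

theorem kernelSection_apply (x y : UnitCube s) : kernelSection γ y x = sobolevKernel γ x y := by
  rw [kernelSection, RKHS.kerFun_apply, kernel_anchoredSobolev]

/-- ‖K_x - K_y‖² = K(x,x) - 2K(x,y) + K(y,y) tends to 0. Continuity makes the Bochner integral of x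
↦ K_x available and makes every function of the space continuous. -/
theorem continuous_kernelSection : Continuous (kernelSection γ) := by
  rw [continuous_iff_continuousAt]
  intro y
  rw [ContinuousAt, tendsto_iff_norm_sub_tendsto_zero]
  have h : ∀ x, ‖kernelSection γ x - kernelSection γ y‖ =
      √(sobolevKernel γ x x - 2 * sobolevKernel γ x y + sobolevKernel γ y y) := by
    intro x
    rw [norm_eq_sqrt_real_inner]
    simp only [inner_sub_left, inner_sub_right, inner_kernelSection, kernelSection_apply,
      sobolevKernel_comm γ y x]
    ring_nf
  have hK := continuous_sobolevKernel γ
  have hc : Continuous fun x =>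
      √(sobolevKernel γ x x - 2 * sobolevKernel γ x y + sobolevKernel γ y y) :=
    (((hK.comp (continuous_id.prodMk continuous_id)).sub
      ((hK.comp (continuous_id.prodMk continuous_const)).const_mul 2)).add
        continuous_const).sqrt
  have h0 := hc.tendsto y
  simp only [h]
  convert h0 using 2
  ring_nf
  simp

theorem continuous_anchoredSobolev (f : AnchoredSobolev γ) : Continuous f := by
  have h : (f : UnitCube s → ℝ) = fun x => inner ℝ f (kernelSection γ x) :=
    funext fun x => (inner_kernelSection γ f x).symm
  rw [h]
  exact continuous_const.inner (continuous_kernelSection γ)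

theorem integrable_of_continuous {E : Type*} [NormedAddCommGroup E] {g : UnitCube s → E}
    (hg : Continuous g) : Integrable g :=
  hg.integrable_of_hasCompactSupport (HasCompactSupport.of_compactSpace g)

/-- The element of the space that represents the integration error. -/
noncomputable def errorRepresenter (x : ℕ → UnitCube s) (N : ℕ) : AnchoredSobolev γ :=
  (∫ y, kernelSection γ y) - (1 / (N : ℝ)) • ∑ n ∈ Finset.range N, kernelSection γ (x n)

theorem qmcError_eq_inner (x : ℕ → UnitCube s) (N : ℕ) (f : AnchoredSobolev γ) :
    qmcError x N f = inner ℝ f (errorRepresenter γ x N) := by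
  rw [errorRepresenter, inner_sub_right, inner_smul_right, inner_sum,
    ← integral_inner (integrable_of_continuous (continuous_kernelSection γ))]
  simp only [inner_kernelSection]
  rfl

theorem abs_qmcError_le (x : ℕ → UnitCube s) (N : ℕ) (f : {f : AnchoredSobolev γ // ‖f‖ ≤ 1}) :
    |qmcError x N (f : AnchoredSobolev γ)| ≤ ‖errorRepresenter γ x N‖ := by
  rw [qmcError_eq_inner]
  exact (abs_real_inner_le_norm _ _).trans (mul_le_of_le_one_left (norm_nonneg _) f.2)

theorem bddAbove_abs_qmcError (x : ℕ → UnitCube s) (N : ℕ) :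
    BddAbove (Set.range fun f : {f : AnchoredSobolev γ // ‖f‖ ≤ 1} =>
      |qmcError x N (f : AnchoredSobolev γ)|) :=
  ⟨_, Set.forall_mem_range.2 (abs_qmcError_le γ x N)⟩

theorem worstCaseError_eq_norm (x : ℕ → UnitCube s) (N : ℕ) :
    worstCaseError (AnchoredSobolev γ) x N = ‖errorRepresenter γ x N‖ := by
  set h := errorRepresenter γ x N with hh
  have hne : Nonempty {f : AnchoredSobolev γ // ‖f‖ ≤ 1} := ⟨⟨0, by simp⟩⟩
  refine le_antisymm (ciSup_le (abs_qmcError_le γ x N)) ?_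
  have hle : ‖(‖h‖⁻¹ : ℝ) • h‖ ≤ 1 := by
    rw [norm_smul, norm_inv, norm_norm]
    exact inv_mul_le_one
  -- The supremum is attained at the normalized representer; when h = 0 this is 0, since 0⁻¹ = 0.
  refine le_ciSup_of_le (bddAbove_abs_qmcError γ x N) ⟨(‖h‖⁻¹ : ℝ) • h, hle⟩ ?_
  refine le_trans (le_of_eq ?_) (le_abs_self _)
  rw [qmcError_eq_inner, ← hh, real_inner_smul_left, real_inner_self_eq_norm_sq]
  by_cases h0 : ‖h‖ = 0
  · simp [h0]
  · field_simp

theorem errorRepresenter_apply (x : ℕ → UnitCube s) (N : ℕ) (y : UnitCube s) :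
    errorRepresenter γ x N y = sobolevKernelMean γ y -
      (1 / (N : ℝ)) * ∑ n ∈ Finset.range N, sobolevKernel γ (x n) y := by
  rw [← inner_kernelSection, real_inner_comm, ← qmcError_eq_inner, qmcError]
  simp only [kernelSection_apply, integral_sobolevKernel]

/-- ‖h‖² = ⟨h, h⟩ is the integration error of the function h itself. -/
theorem worstCaseError_sq (x : ℕ → UnitCube s) (N : ℕ) :
    worstCaseError (AnchoredSobolev γ) x N ^ 2 =
      ∏ j, (1 + (γ j : ℝ) / 3) -
        2 * (1 / (N : ℝ)) * ∑ n ∈ Finset.range N, sobolevKernelMean γ (x n) +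
        (1 / (N : ℝ)) ^ 2 * ∑ n ∈ Finset.range N, ∑ m ∈ Finset.range N,
          sobolevKernel γ (x n) (x m) := by
  have hK : ∀ t, Continuous fun y => sobolevKernel γ t y := fun t =>
    (continuous_sobolevKernel γ).comp (continuous_const.prodMk continuous_id)
  rw [worstCaseError_eq_norm, ← real_inner_self_eq_norm_sq, ← qmcError_eq_inner, qmcError]
  simp only [errorRepresenter_apply]
  rw [integral_sub (integrable_of_continuous (continuous_sobolevKernelMean γ))
    ((integrable_finsetSum _ fun n _ => integrable_of_continuous (hK (x n))).const_mul _),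
    integral_const_mul, integral_finsetSum _ fun n _ => integrable_of_continuous (hK (x n)),
    integral_sobolevKernelMean, Finset.sum_sub_distrib, ← Finset.mul_sum]
  have hmean : ∀ t, ∫ y, sobolevKernel γ t y = sobolevKernelMean γ t := fun t => by
    simp only [sobolevKernel_comm γ t, integral_sobolevKernel]
  simp only [hmean]
  rw [Finset.sum_comm]
  ring

end Kernel

/-! ### Products over the coordinates -/

/-- Induction on the number of factors; absolute summability is carried along because the product of
two series requires it. -/
theorem hasSum_prod_of_summable_norm {s : ℕ} (f : Fin s → ℕ → ℂ) (a : Fin s → ℂ)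
    (hf : ∀ j, HasSum (f j) (a j)) (hn : ∀ j, Summable fun k => ‖f j k‖) :
    (Summable fun k : Fin s → ℕ => ‖∏ j, f j (k j)‖) ∧
      HasSum (fun k : Fin s → ℕ => ∏ j, f j (k j)) (∏ j, a j) := by
  induction s with
  | zero => exact ⟨(hasSum_fintype _).summable, by simp⟩
  | succ s ih =>
    obtain ⟨ih1, ih2⟩ := ih (fun j => f j.succ) (fun j => a j.succ) (fun j => hf _) fun j => hn _
    have h1 : Summable fun t : ℕ × (Fin s → ℕ) => ‖f 0 t.1 * ∏ j, f j.succ (t.2 j)‖ := by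
      simp only [norm_mul]
      exact (hn 0).mul_of_nonneg ih1 (fun _ => norm_nonneg _) fun _ => norm_nonneg _
    have h2 := (hf 0).mul ih2 h1.of_norm
    let e : ℕ × (Fin s → ℕ) ≃ (Fin (s + 1) → ℕ) := Fin.consEquiv fun _ => ℕ
    have he : ∀ t : ℕ × (Fin s → ℕ), ∏ j, f j (e t j) = f 0 t.1 * ∏ j, f j.succ (t.2 j) := by
      intro t
      rw [Fin.prod_univ_succ]
      simp [e, Fin.consEquiv]
    constructor
    · rw [← e.summable_iff]
      exact h1.congr fun t => by rw [Function.comp_apply, he]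
    · rw [← e.hasSum_iff, Fin.prod_univ_succ]
      exact h2.congr_fun he

theorem integrableOn_prod_and_integral {s : ℕ} (g : Fin s → ℝ → ℝ)
    (hg : ∀ j, IntegrableOn (g j) (Set.Ico 0 1)) :
    IntegrableOn (fun σ : Fin s → ℝ => ∏ j, g j (σ j))
        (Set.univ.pi fun _ : Fin s => Set.Ico (0 : ℝ) 1) ∧
      ∫ σ in Set.univ.pi (fun _ : Fin s => Set.Ico (0 : ℝ) 1), ∏ j, g j (σ j) =
        ∏ j, ∫ t in Set.Ico (0 : ℝ) 1, g j t := by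
  have h : (volume : Measure (Fin s → ℝ)).restrict (Set.univ.pi fun _ => Set.Ico (0 : ℝ) 1) =
      Measure.pi fun _ => volume.restrict (Set.Ico (0 : ℝ) 1) := by
    rw [volume_pi, Measure.restrict_pi_pi]
  rw [IntegrableOn, h]
  exact ⟨Integrable.fintype_prod hg, integral_fintype_prod_eq_prod g⟩

/-! ### Integrals over the shift in one coordinate -/

section Shift

variable {p : ℕ} [Fact p.Prime]

theorem integrableOn_one_add_mul_min (γ : ℝ) (x y : ℤ_[p]) :
    IntegrableOn (fun σ => 1 + γ * min (1 - monna p (x + monnaInv p σ))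
      (1 - monna p (y + monnaInv p σ))) (Set.Ico 0 1) := by
  refine (integrable_const _).add (Integrable.const_mul (Integrable.of_bound (C := 1)
    ((aestronglyMeasurable_const.sub (aestronglyMeasurable_monna_shift x)).inf
      (aestronglyMeasurable_const.sub (aestronglyMeasurable_monna_shift y)))
    (Eventually.of_forall fun σ => ?_)) _)
  have hx := monna_mem_unitInterval p (x + monnaInv p σ)
  have hy := monna_mem_unitInterval p (y + monnaInv p σ)
  change ‖min (1 - monna p (x + monnaInv p σ)) (1 - monna p (y + monnaInv p σ))‖ ≤ 1
  rw [Real.norm_of_nonneg (le_min (sub_nonneg.2 hx.2) (sub_nonneg.2 hy.2))]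
  exact min_le_of_left_le (by linarith [hx.1])

theorem integrableOn_monna_shift_sq (x : ℤ_[p]) :
    IntegrableOn (fun σ => monna p (x + monnaInv p σ) ^ 2) (Set.Ico 0 1) := by
  refine Integrable.of_bound (C := 1) ((aestronglyMeasurable_monna_shift x).pow 2)
    (Eventually.of_forall fun σ => ?_)
  have hx := monna_mem_unitInterval p (x + monnaInv p σ)
  rw [norm_pow, Real.norm_of_nonneg hx.1]
  exact pow_le_one₀ hx.1 hx.2

theorem integrableOn_one_add_mul_one_sub_sq (γ : ℝ) (x : ℤ_[p]) :
    IntegrableOn (fun σ => 1 + γ * ((1 - monna p (x + monnaInv p σ) ^ 2) / 2)) (Set.Ico 0 1) :=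
  (integrable_const _).add ((((integrable_const _).sub
    (integrableOn_monna_shift_sq x)).div_const 2).const_mul γ)

theorem integral_one_add_mul_one_sub_sq (γ : ℝ) (x : ℤ_[p]) :
    ∫ σ in Set.Ico (0 : ℝ) 1, (1 + γ * ((1 - monna p (x + monnaInv p σ) ^ 2) / 2)) =
      1 + γ / 3 := by
  have h : ∀ σ, 1 + γ * ((1 - monna p (x + monnaInv p σ) ^ 2) / 2) =
      (1 + γ / 2) - γ / 2 * monna p (x + monnaInv p σ) ^ 2 := fun σ => by ring
  simp only [h]
  rw [integral_sub (integrable_const _) ((integrableOn_monna_shift_sq x).const_mul _),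
    integral_const_mul, integral_monna_shift_sq]
  simp
  ring

end Shift

/-! ### Averaging over shifts of the Halton sequence -/

section Halton

variable {s : ℕ} (p : Fin s → ℕ) [∀ j, Fact (p j).Prime] (γ : Fin s → {g : ℝ // 0 < g})

/-- The average of the kernel at two points of the Halton sequence under a random shift. -/
noncomputable def shiftedKernelMean (n m : ℕ) : ℝ :=
  ∏ j, ∫ t in Set.Ico (0 : ℝ) 1,
    (1 + (γ j : ℝ) * min (1 - monna (p j) (monnaInv (p j) (halton p n j) + monnaInv (p j) t))
      (1 - monna (p j) (monnaInv (p j) (halton p m j) + monnaInv (p j) t)))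

theorem sobolevKernel_shiftedHalton (n m : ℕ) :
    IntegrableOn (fun σ => sobolevKernel γ (shiftedHalton p σ n) (shiftedHalton p σ m))
        (Set.univ.pi fun _ : Fin s => Set.Ico (0 : ℝ) 1) ∧
      ∫ σ in Set.univ.pi (fun _ : Fin s => Set.Ico (0 : ℝ) 1),
        sobolevKernel γ (shiftedHalton p σ n) (shiftedHalton p σ m) = shiftedKernelMean p γ n m :=
  integrableOn_prod_and_integral (fun j t =>
    1 + (γ j : ℝ) * min (1 - monna (p j) (monnaInv (p j) (halton p n j) + monnaInv (p j) t))
      (1 - monna (p j) (monnaInv (p j) (halton p m j) + monnaInv (p j) t)))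
    fun _ => integrableOn_one_add_mul_min _ _ _

theorem sobolevKernelMean_shiftedHalton (n : ℕ) :
    IntegrableOn (fun σ => sobolevKernelMean γ (shiftedHalton p σ n))
        (Set.univ.pi fun _ : Fin s => Set.Ico (0 : ℝ) 1) ∧
      ∫ σ in Set.univ.pi (fun _ : Fin s => Set.Ico (0 : ℝ) 1),
        sobolevKernelMean γ (shiftedHalton p σ n) = ∏ j, (1 + (γ j : ℝ) / 3) := by
  have h := integrableOn_prod_and_integral (fun j t => 1 + (γ j : ℝ) *
    ((1 - monna (p j) (monnaInv (p j) (halton p n j) + monnaInv (p j) t) ^ 2) / 2))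
    fun _ => integrableOn_one_add_mul_one_sub_sq _ _
  simp only [integral_one_add_mul_one_sub_sq] at h
  exact h

/-- Every shifted kernel mean averages to C = ∏(1 + γ_j/3), so the first two terms of
`worstCaseError_sq` give C - 2C = -C. -/
theorem worstCaseError_sq_shiftedHalton {N : ℕ} (hN : 0 < N) :
    IntegrableOn (fun σ => worstCaseError (AnchoredSobolev γ) (shiftedHalton p σ) N ^ 2)
        (Set.univ.pi fun _ : Fin s => Set.Ico (0 : ℝ) 1) ∧
      ∫ σ in Set.univ.pi (fun _ : Fin s => Set.Ico (0 : ℝ) 1),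
        worstCaseError (AnchoredSobolev γ) (shiftedHalton p σ) N ^ 2 =
      (1 / (N : ℝ)) ^ 2 * ∑ n ∈ Finset.range N, ∑ m ∈ Finset.range N, shiftedKernelMean p γ n m -
        ∏ j, (1 + (γ j : ℝ) / 3) := by
  simp only [worstCaseError_sq]
  have hvol : (volume : Measure (Fin s → ℝ)).real
      (Set.univ.pi fun _ => Set.Ico (0 : ℝ) 1) = 1 := by
    rw [measureReal_def, Real.volume_pi_Ico]
    simp
  have hfin : (volume : Measure (Fin s → ℝ)) (Set.univ.pi fun _ => Set.Ico (0 : ℝ) 1) ≠ ⊤ := by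
    rw [Real.volume_pi_Ico]
    simp
  have hC : IntegrableOn (fun _ : Fin s → ℝ => ∏ j, (1 + (γ j : ℝ) / 3))
      (Set.univ.pi fun _ => Set.Ico (0 : ℝ) 1) := integrableOn_const hfin
  have hA : IntegrableOn (fun σ => ∑ n ∈ Finset.range N, sobolevKernelMean γ (shiftedHalton p σ n))
      (Set.univ.pi fun _ => Set.Ico (0 : ℝ) 1) :=
    integrable_finsetSum _ fun n _ => (sobolevKernelMean_shiftedHalton p γ n).1
  have hB' : ∀ n, IntegrableOn (fun σ => ∑ m ∈ Finset.range N,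
      sobolevKernel γ (shiftedHalton p σ n) (shiftedHalton p σ m))
      (Set.univ.pi fun _ => Set.Ico (0 : ℝ) 1) := fun n =>
    integrable_finsetSum _ fun m _ => (sobolevKernel_shiftedHalton p γ n m).1
  have hB : IntegrableOn (fun σ => ∑ n ∈ Finset.range N, ∑ m ∈ Finset.range N,
      sobolevKernel γ (shiftedHalton p σ n) (shiftedHalton p σ m))
      (Set.univ.pi fun _ => Set.Ico (0 : ℝ) 1) := integrable_finsetSum _ fun n _ => hB' n
  have hCA : IntegrableOn (fun σ => ∏ j, (1 + (γ j : ℝ) / 3) - 2 * (1 / (N : ℝ)) *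
      ∑ n ∈ Finset.range N, sobolevKernelMean γ (shiftedHalton p σ n))
      (Set.univ.pi fun _ => Set.Ico (0 : ℝ) 1) := hC.sub (hA.const_mul _)
  refine ⟨hCA.add (hB.const_mul _), ?_⟩
  rw [integral_add hCA (hB.const_mul _),
    integral_sub hC (hA.const_mul _), integral_const_mul, integral_const_mul,
    integral_finsetSum _ fun n _ => (sobolevKernelMean_shiftedHalton p γ n).1,
    integral_finsetSum _ fun n _ => hB' n]
  simp only [(sobolevKernelMean_shiftedHalton p γ _).2]
  have hB2 : ∀ n, ∫ σ in Set.univ.pi (fun _ : Fin s => Set.Ico (0 : ℝ) 1),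
      ∑ m ∈ Finset.range N, sobolevKernel γ (shiftedHalton p σ n) (shiftedHalton p σ m) =
      ∑ m ∈ Finset.range N, shiftedKernelMean p γ n m := fun n => by
    rw [integral_finsetSum _ fun m _ => (sobolevKernel_shiftedHalton p γ n m).1]
    exact Finset.sum_congr rfl fun m _ => (sobolevKernel_shiftedHalton p γ n m).2
  simp only [hB2, setIntegral_const, hvol, Finset.sum_const, Finset.card_range, nsmul_eq_mul,
    smul_eq_mul]
  have hN' : (N : ℝ) ≠ 0 := by positivity
  field_simp
  ring

theorem hasSum_shiftedKernelMean (n m : ℕ) :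
    HasSum (fun k : Fin s → ℕ => (rCoeffVec p γ k : ℂ) *
        (padicBetaVec p k (halton p m) * starRingEnd ℂ (padicBetaVec p k (halton p n))))
      (shiftedKernelMean p γ n m : ℂ) := by
  have h := (hasSum_prod_of_summable_norm (fun j k => (rCoeff (p j) (γ j) k : ℂ) *
    (padicBeta (p j) k (halton p m j) * starRingEnd ℂ (padicBeta (p j) k (halton p n j)))) _
    (fun j => hasSum_rCoeff_mul_padicChar (γ j).2.le _ _) fun j => ?_).2
  · convert h using 1
    · funext k
      simp only [rCoeffVec, padicBetaVec, Complex.ofReal_prod, map_prod, Finset.prod_mul_distrib]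
    · simp only [shiftedKernelMean, Complex.ofReal_prod]
  · refine ((summable_rCoeff (Nat.Prime.one_lt (Fact.out : (p j).Prime)) (γ j).2.le).norm).congr fun k => ?_
    rw [norm_mul, norm_mul, RCLike.norm_conj, padicBeta, padicBeta, norm_padicChar, norm_padicChar,
      Complex.norm_real, mul_one, mul_one]

/-- A finite double sum of the character expansions may be taken termwise, and ∑_n ∑_m β_k(x_m) conj
β_k(x_n) is the squared modulus of ∑_n β_k(x_n). -/
theorem hasSum_rCoeffVec_mul_norm_sq (N : ℕ) :
    HasSum (fun k : Fin s → ℕ => rCoeffVec p γ k *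
        ‖(1 / (N : ℂ)) * ∑ n ∈ Finset.range N, padicBetaVec p k (halton p n)‖ ^ 2)
      ((1 / (N : ℝ)) ^ 2 * ∑ n ∈ Finset.range N, ∑ m ∈ Finset.range N,
        shiftedKernelMean p γ n m) := by
  rw [← Complex.hasSum_ofReal]
  have h := (hasSum_sum fun n (_ : n ∈ Finset.range N) => hasSum_sum fun m
    (_ : m ∈ Finset.range N) => hasSum_shiftedKernelMean p γ n m).mul_left ((1 / (N : ℂ)) ^ 2)
  have ha : (((1 / (N : ℝ)) ^ 2 * ∑ n ∈ Finset.range N, ∑ m ∈ Finset.range N,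
      shiftedKernelMean p γ n m : ℝ) : ℂ) = (1 / (N : ℂ)) ^ 2 * ∑ n ∈ Finset.range N,
        ∑ m ∈ Finset.range N, (shiftedKernelMean p γ n m : ℂ) := by
    push_cast
    rfl
  rw [ha]
  refine HasSum.congr_fun h fun k => ?_
  · set b := fun n => padicBetaVec p k (halton p n)
    have h1 : ((‖(1 / (N : ℂ)) * ∑ n ∈ Finset.range N, b n‖ ^ 2 : ℝ) : ℂ) =
        ((1 / (N : ℂ)) * ∑ n ∈ Finset.range N, b n) *
          starRingEnd ℂ ((1 / (N : ℂ)) * ∑ n ∈ Finset.range N, b n) := by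
      rw [Complex.mul_conj, Complex.normSq_eq_norm_sq]
    have h2 : ∑ n ∈ Finset.range N, ∑ m ∈ Finset.range N,
        (rCoeffVec p γ k : ℂ) * (b m * starRingEnd ℂ (b n)) = (rCoeffVec p γ k : ℂ) *
          ((∑ n ∈ Finset.range N, b n) * starRingEnd ℂ (∑ n ∈ Finset.range N, b n)) := by
      simp only [← Finset.mul_sum, ← Finset.sum_mul, map_sum]
    rw [h2, Complex.ofReal_mul, h1]
    simp only [map_mul, map_div₀, map_one, Complex.conj_natCast]
    ring

theorem rCoeffVec_zero_mul_norm_sq {N : ℕ} (hN : 0 < N) :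
    rCoeffVec p γ 0 *
        ‖(1 / (N : ℂ)) * ∑ n ∈ Finset.range N, padicBetaVec p 0 (halton p n)‖ ^ 2 =
      ∏ j, (1 + (γ j : ℝ) / 3) := by
  have hN' : (N : ℂ) ≠ 0 := by exact_mod_cast hN.ne'
  simp [rCoeffVec, rCoeff, padicBetaVec, padicBeta, padicChar_zero, hN']

end Halton

theorem proposition3 {s : ℕ} (p : Fin s → ℕ) [∀ j, Fact (p j).Prime] (hp : Function.Injective p)
    (γ : Fin s → {g : ℝ // 0 < g}) (N : ℕ) (hN : 0 < N) :
    (∀ f : AnchoredSobolev γ, Integrable (f : UnitCube s → ℝ)) ∧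
    (∀ σ ∈ Set.univ.pi (fun _ : Fin s => Set.Ico (0 : ℝ) 1),
      BddAbove (Set.range fun f : {f : AnchoredSobolev γ // ‖f‖ ≤ 1} =>
        |qmcError (shiftedHalton p σ) N (f : AnchoredSobolev γ)|)) ∧
    IntegrableOn
      (fun σ => worstCaseError (AnchoredSobolev γ) (shiftedHalton p σ) N ^ 2)
      (Set.univ.pi (fun _ : Fin s => Set.Ico (0 : ℝ) 1)) ∧
    HasSum
      (fun k : {k : Fin s → ℕ // k ≠ 0} =>
        rCoeffVec p γ k *
          ‖(1 / (N : ℂ)) * ∑ n ∈ Finset.range N, padicBetaVec p k (halton p n)‖ ^ 2)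
      (rmsWorstCaseError p γ N ^ 2) := by

  obtain ⟨hint, hval⟩ := worstCaseError_sq_shiftedHalton p γ hN
  refine ⟨fun f => integrable_of_continuous (continuous_anchoredSobolev γ f),
    fun σ _ => bddAbove_abs_qmcError γ _ N, hint, ?_⟩
  -- The constant subtracted in the averaged error is exactly the k = 0 term of the series, so
  -- removing that index absorbs it.
  rw [rmsWorstCaseError, Real.sq_sqrt (integral_nonneg fun σ => sq_nonneg _), hval,
    ← rCoeffVec_zero_mul_norm_sq p γ hN]
  have h := hasSum_rCoeffVec_mul_norm_sq p γ N
  have h' := (Finset.hasSum_compl_iff (f := fun k : Fin s → ℕ => rCoeffVec p γ k *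
    ‖(1 / (N : ℂ)) * ∑ n ∈ Finset.range N, padicBetaVec p k (halton p n)‖ ^ 2) {0}
    (a := _ - _)).2 (by rw [Finset.sum_singleton, sub_add_cancel]; exact h)
  let e : {k : Fin s → ℕ // k ≠ 0} ≃ {k : Fin s → ℕ // k ∉ ({0} : Finset (Fin s → ℕ))} :=
    Equiv.subtypeEquivRight fun k => by simp
  exact e.hasSum_iff.2 h'
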